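/- Let $K$ be a field of characteristic $0$ and let $q,t\in K$, $t\neq 0$, be such that $q^k\ne 1$ and $t^k\neq 1$ for all $k\ge 1$ (for instance $K=\mathbb{C}(q,t)$ with indeterminates $q,t$). Let $\Lambda_n$ be the ring of symmetric polynomials in $x_1,\dots,x_n$ over $K$, and $\Lambda$ the ring of symmetric functions in $x_1,x_2,\dots$ over $K$. Let $e_j$ denote the elementary symmetric functions. The Macdonald operators on $\Lambda_n$ are $$D_n^r=\sum_{I\subseteq\{1,\dots,n\},\,|I|=r} t^{r(r-1)/2}\prod_{i\in I,\,j\notin I}\frac{tx_i-x_j}{x_i-x_j}\,\prod_{i\in I}T_{q,x_i},$$ where $T_{q,x_i}$ replaces $x_i$ by $qx_i$ (so $D_n^0=1$, and $D_n^r=0$ for $r>n$). The Macdonald functions $P_\mu=P_\mu(x;q,t)\in\Lambda$, indexed by partitions $\mu$, are the symmetric functions with $P_\lambda=m_\lambda+\sum_{\mu<\lambda}u_{\lambda\mu}m_\mu$ (monomial symmetric functions, $u_{\lambda\mu}\in K$, dominance order) that are pairwise orthogonal for the bilinear form on $\Lambda$ given on power sums by $(p_\lambda,p_\mu)_{q,t}=\delta_{\lambda\mu}z_\lambda\prod_i\frac{1-q^{\lambda_i}}{1-t^{\lambda_i}}$;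 the Macdonald polynomial $P_\mu(x_1,\dots,x_n;q,t)$ is obtained by setting $x_i=0$ for $i>n$. (For special values of $q,t$ the assertions about $P_\mu$ are made whenever such a family exists.) For $n,r\ge 0$ put $$E^r_n=\sum_{j=0}^{r}(-1)^j t^{(j^2-3j)/2}\,e_j(1,t^{-1},\dots,t^{-(n+j-2)})\;t^{-(r-j)n}D_n^{r-j}.$$ Then: (1) $E^r_n|_{x_n=0}=E^r_{n-1}$ for all $n\ge 1$, that is, $(E^r_nf)|_{x_n=0}=E^r_{n-1}(f|_{x_n=0})$ for all $f\in\Lambda_n$. (2) For every partition $\mu$ and every $n\geq \ell(\mu)$, the Macdonald polynomial $P_\mu(x_1,\dots,x_n;q,t)$ is an eigenvector of $E^r_n$ with eigenvalue $$e^r_n(\mu)=\sum_{j=0}^{r}(-1)^jt^{(j^2-3j)/2}\,e_j(1,t^{-1},\dots,t^{-(n+j-2)})\;e_{r-j}(q^{\mu_1}t^{-1},\dots,q^{\mu_n}t^{-n}).$$ (3) There is a unique linear operator $E^r$ on $\Lambda$ with $(E^rf)(x_1,\dots,x_n)=E^r_n\bigl(f(x_1,\dots,x_n)\bigr)$ for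 all $n\ge 0$ and $f\in\Lambda$, where $f(x_1,\dots,x_n)\in\Lambda_n$ is obtained from $f$ by setting $x_i=0$ for $i>n$. For every Hausdorff ring topology on $K$ with $t^{-N}\to 0$ as $N\to\infty$ (for instance $K=\mathbb{C}$, $|t|>1$, or $\mathbb{C}(q,t)$ with the $t^{-1}$-adic topology, that is, expansion in powers of $t^{-1}$), the Macdonald function $P_\mu$ is an eigenvector of $E^r$ with eigenvalue $$e^r(\mu)=\sum_{j=0}^{r}(-1)^jt^{(j^2-3j)/2}\,e_j(1,t^{-1},t^{-2},\dots)\;e_{r-j}(q^{\mu_1}t^{-1},q^{\mu_2}t^{-2},\dots),$$ where $\mu_i=0$ for $i>\ell(\mu)$ and the elementary symmetric functions of infinitely many arguments are the (existing) limits in $K$ of those of the first $N$ arguments as $N\to\infty$. -/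

import Mathlib

open MvPolynomial

section
variable {K : Type*} [Field K] {n : ℕ}

/-- The substitution `X i ↦ X j`. -/
noncomputable def Macdonald.identify (K : Type*) [Field K] {n : ℕ} (i j : Fin n) :
    MvPolynomial (Fin n) K →ₐ[K] MvPolynomial (Fin n) K :=
  aeval fun k => if k = i then X j else X k

namespace Macdonald

theorem sub_dvd_sub_identify (i j : Fin n) (h : MvPolynomial (Fin n) K) :
    (X i - X j) ∣ h - identify K i j h := by
  induction h using MvPolynomial.induction_on with
  | C a => simp [identify]
  | add p q hp hq =>
    have : p + q - identify K i j (p + q)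
      = (p - identify K i j p) + (q - identify K i j q) := by rw [map_add]; ring
    rw [this]; exact dvd_add hp hq
  | mul_X p k hp =>
    have : p * X k - identify K i j (p * X k)
      = (p - identify K i j p) * X k
        + identify K i j p * (X k - identify K i j (X k)) := by rw [map_mul]; ring
    rw [this]
    refine dvd_add (hp.mul_right _) (Dvd.dvd.mul_left ?_ _)
    by_cases hk : k = i
    · subst hk; simp [identify]
    · simp [identify, hk]

theorem sub_dvd_iff (i j : Fin n) (h : MvPolynomial (Fin n) K) :
    (X i - X j) ∣ h ↔ identify K i j h = 0 := by
  constructor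
  · rintro ⟨g, rfl⟩
    by_cases hij : j = i
    · subst hij; simp
    · simp [identify, hij]
  · intro h0
    simpa [h0] using sub_dvd_sub_identify i j h

theorem X_sub_X_ne_zero {i j : Fin n} (hij : i ≠ j) :
    (X i - X j : MvPolynomial (Fin n) K) ≠ 0 :=
  sub_ne_zero.2 fun h => hij (X_injective h)

theorem prime_X_sub_X {i j : Fin n} (hij : i ≠ j) :
    Prime (X i - X j : MvPolynomial (Fin n) K) := by
  refine ⟨X_sub_X_ne_zero hij, ?_, ?_⟩
  · intro hu
    have := (sub_dvd_iff (K := K) i j 1).1 hu.dvd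
    simp at this
  · intro a b hab
    rw [sub_dvd_iff, map_mul, mul_eq_zero] at hab
    simpa only [sub_dvd_iff] using hab

theorem prod_sub_dvd (S : Finset (Fin n × Fin n)) (hS : ∀ p ∈ S, p.1 ≠ p.2)
    (hS' : ∀ p ∈ S, p.swap ∉ S) (h : MvPolynomial (Fin n) K)
    (h0 : ∀ p ∈ S, identify K p.1 p.2 h = 0) :
    (∏ p ∈ S, (X p.1 - X p.2 : MvPolynomial (Fin n) K)) ∣ h := by
  refine Finset.prod_dvd_of_isRelPrime ?_ fun p hp => (sub_dvd_iff _ _ _).2 (h0 p hp)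
  rintro ⟨i, j⟩ hp ⟨k, l⟩ hp' hne
  have hij : i ≠ j := hS _ hp
  have hkl : k ≠ l := hS _ hp'
  have hsw : ¬ (k = j ∧ l = i) := by
    rintro ⟨rfl, rfl⟩
    exact hS' _ hp hp'
  show IsRelPrime (X i - X j : MvPolynomial (Fin n) K) (X k - X l)
  rw [(prime_X_sub_X hij).irreducible.isRelPrime_iff_not_dvd, sub_dvd_iff]
  simp only [identify, map_sub, aeval_X]
  intro h
  have h := sub_eq_zero.1 h
  have hinj := X_injective (R := K) (σ := Fin n)
  split_ifs at h with h1 h2 h2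
  · exact hkl (h1.trans h2.symm)
  · exact hne (by rw [h1, hinj h])
  · exact hsw ⟨hinj h, h2⟩
  · exact hkl (hinj h)

/-- The Vandermonde determinant in the variables -/
noncomputable def vdm (K : Type*) [Field K] (n : ℕ) : MvPolynomial (Fin n) K :=
  (Matrix.vandermonde (fun i : Fin n => (X i : MvPolynomial (Fin n) K))).det

theorem vdm_ne_zero : vdm K n ≠ 0 :=
  Matrix.det_vandermonde_ne_zero_iff.2 X_injective

theorem identify_vdm {i j : Fin n} (hij : i ≠ j) : identify K i j (vdm K n) = 0 := by
  rw [vdm, AlgHom.map_det]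
  refine Matrix.det_zero_of_row_eq hij ?_
  ext k : 1
  simp [Matrix.vandermonde_apply, identify, hij.symm]

theorem rename_swap_vdm {i j : Fin n} (hij : i ≠ j) :
    rename (Equiv.swap i j) (vdm K n) = - vdm K n := by
  have h := Matrix.det_permute (Equiv.swap i j)
    (Matrix.vandermonde (fun i : Fin n => (X i : MvPolynomial (Fin n) K)))
  rw [Equiv.Perm.sign_swap hij] at h
  rw [vdm, AlgHom.map_det]
  convert h using 2
  · ext a b : 2
    simp [Matrix.vandermonde_apply]
  · simp

theorem identify_rename_swap (i j : Fin n) (h : MvPolynomial (Fin n) K) :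
    identify K i j (rename (Equiv.swap i j) h) = identify K i j h := by
  rw [identify, aeval_rename]
  congr 2
  ext k : 1
  simp only [Function.comp, Equiv.swap_apply_def]
  split_ifs <;> simp_all

theorem vdm_dvd [CharZero K] (h : MvPolynomial (Fin n) K)
    (hh : ∀ i j : Fin n, i ≠ j → rename (Equiv.swap i j) h = - h) : vdm K n ∣ h := by
  have hv : vdm K n =
      ∏ p ∈ (Finset.univ : Finset (Fin n × Fin n)).filter (fun p => p.2 < p.1),
        (X p.1 - X p.2 : MvPolynomial (Fin n) K) := by
    rw [vdm, Matrix.det_vandermonde, Finset.prod_sigma']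
    refine Finset.prod_bij' (fun p _ => (p.2, p.1)) (fun p _ => ⟨p.2, p.1⟩) ?_ ?_ ?_ ?_ ?_ <;>
      simp
  rw [hv]
  refine prod_sub_dvd _ (by simp +contextual [ne_of_gt]) (by simp; omega) h ?_
  intro p hp
  have hne : p.1 ≠ p.2 := by simp at hp; exact ne_of_gt hp
  have h1 := identify_rename_swap p.1 p.2 h
  rw [hh _ _ hne, map_neg] at h1
  exact self_eq_neg.1 h1.symm


/-! ### The Macdonald operators -/

/-- The ring `Λ_n` of symmetric polynomials in `x_1, …, x_n` over `K`. -/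
abbrev SymPoly (K : Type*) [Field K] (n : ℕ) : Subalgebra K (MvPolynomial (Fin n) K) :=
  symmetricSubalgebra (Fin n) K

/-- The field `K(x_1, …, x_n)` of rational functions. -/
abbrev RatFun (K : Type*) [Field K] (n : ℕ) : Type _ := FractionRing (MvPolynomial (Fin n) K)

/-- The variable `x_i` as a rational function. -/
noncomputable def rx (K : Type*) [Field K] {n : ℕ} (i : Fin n) : RatFun K n :=
  algebraMap (MvPolynomial (Fin n) K) (RatFun K n) (X i)

/-- `∏_{i ∈ I} T_{q,x_i}`: multiply the variables `x_i`, `i ∈ I`, by `q`. -/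
noncomputable def shift (q : K) (I : Finset (Fin n)) :
    MvPolynomial (Fin n) K →ₐ[K] MvPolynomial (Fin n) K :=
  aeval fun i => if i ∈ I then C q * X i else X i

/-- `A_I(x; t) = t^{r(r-1)/2} ∏_{i ∈ I, j ∉ I} (t x_i - x_j) / (x_i - x_j)`, where `r = |I|`. -/
noncomputable def coeffA (t : K) (I : Finset (Fin n)) : RatFun K n :=
  algebraMap K (RatFun K n) (t ^ (I.card * (I.card - 1) / 2)) *
    ∏ i ∈ I, ∏ j ∈ Iᶜ, (t • rx K i - rx K j) / (rx K i - rx K j)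

/-- `D_n^r f = ∑_{|I| = r} A_I · (∏_{i ∈ I} T_{q,x_i}) f`, a priori a rational function. -/
noncomputable def ratD (q t : K) (n r : ℕ) : MvPolynomial (Fin n) K →ₗ[K] RatFun K n :=
  ∑ I ∈ Finset.powersetCard r (Finset.univ : Finset (Fin n)),
    LinearMap.mulLeft K (coeffA t I) ∘ₗ
      (IsScalarTower.toAlgHom K (MvPolynomial (Fin n) K) (RatFun K n)).toLinearMap ∘ₗ
        (shift q I).toLinearMap

theorem ratD_apply (q t : K) (n r : ℕ) (f : MvPolynomial (Fin n) K) :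
    ratD q t n r f = ∑ I ∈ Finset.powersetCard r (Finset.univ : Finset (Fin n)),
      coeffA t I * algebraMap (MvPolynomial (Fin n) K) (RatFun K n) (shift q I f) := by
  simp [ratD]

/-- A permutation of the variables, acting on rational functions. -/
noncomputable def permRat (K : Type*) [Field K] {n : ℕ} (σ : Equiv.Perm (Fin n)) :
    RatFun K n ≃+* RatFun K n :=
  IsFractionRing.ringEquivOfRingEquiv (renameEquiv K σ).toRingEquiv

theorem permRat_algebraMap (σ : Equiv.Perm (Fin n)) (f : MvPolynomial (Fin n) K) :
    permRat K σ (algebraMap _ _ f) = algebraMap _ _ (rename σ f) := by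
  simp [permRat]

theorem permRat_coeffA (t : K) (σ : Equiv.Perm (Fin n)) (I : Finset (Fin n)) :
    permRat K σ (coeffA t I) = coeffA t (I.map σ.toEmbedding) := by
  have hx (i : Fin n) : permRat K σ (rx K i) = rx K (σ i) := by
    simp [rx, permRat_algebraMap]
  have hc (a : K) : permRat K σ (algebraMap K (RatFun K n) a) = algebraMap K (RatFun K n) a := by
    rw [IsScalarTower.algebraMap_apply K (MvPolynomial (Fin n) K) (RatFun K n),
      permRat_algebraMap, MvPolynomial.algebraMap_eq, rename_C]
  have hI : (I.map σ.toEmbedding)ᶜ = Iᶜ.map σ.toEmbedding := by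
    ext a
    simp [Finset.mem_map_equiv]
  simp only [coeffA, map_mul, map_prod, map_div₀, map_sub, Algebra.smul_def, hx, hc, hI,
    Finset.card_map, Finset.prod_map]
  rfl

theorem rename_shift (q : K) (σ : Equiv.Perm (Fin n)) (I : Finset (Fin n))
    (f : MvPolynomial (Fin n) K) :
    rename σ (shift q I f) = shift q (I.map σ.toEmbedding) (rename σ f) := by
  rw [shift, shift, aeval_rename, ← AlgHom.comp_apply]
  congr 1
  ext i : 1
  by_cases hi : i ∈ I <;> simp [hi]

theorem permRat_ratD (q t : K) (r : ℕ) (σ : Equiv.Perm (Fin n)) (f : MvPolynomial (Fin n) K)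
    (hf : f.IsSymmetric) : permRat K σ (ratD q t n r f) = ratD q t n r f := by
  rw [ratD_apply, map_sum]
  refine Finset.sum_bij' (fun I _ => I.map σ.toEmbedding) (fun I _ => I.map σ.symm.toEmbedding)
    ?_ ?_ ?_ ?_ ?_
  · simp [Finset.mem_powersetCard]
  · simp [Finset.mem_powersetCard]
  · intro I _; ext a; simp [Finset.mem_map_equiv]
  · intro I _; ext a; simp [Finset.mem_map_equiv]
  · intro I _
    rw [map_mul, permRat_coeffA, permRat_algebraMap, rename_shift, hf σ]

theorem vdm_mul_coeffA (t : K) (I : Finset (Fin n)) :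
    ∃ g : MvPolynomial (Fin n) K,
      algebraMap _ (RatFun K n) (vdm K n) * coeffA t I = algebraMap _ (RatFun K n) g := by
  have hdvd : (∏ p ∈ I ×ˢ Iᶜ, (X p.1 - X p.2 : MvPolynomial (Fin n) K)) ∣ vdm K n := by
    have hne : ∀ p ∈ I ×ˢ Iᶜ, p.1 ≠ p.2 := by
      rintro ⟨i, j⟩ hp (h : i = j)
      subst h
      simp at hp
    refine prod_sub_dvd _ hne ?_ _ fun p hp => identify_vdm (hne p hp)
    rintro ⟨i, j⟩ hp hp'
    simp at hp hp'
    exact hp.2 hp'.1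
  obtain ⟨g, hg⟩ := hdvd
  refine ⟨C (t ^ (I.card * (I.card - 1) / 2)) * g *
    ∏ p ∈ I ×ˢ Iᶜ, (C t * X p.1 - X p.2 : MvPolynomial (Fin n) K), ?_⟩
  have hne : algebraMap _ (RatFun K n)
      (∏ p ∈ I ×ˢ Iᶜ, (X p.1 - X p.2 : MvPolynomial (Fin n) K)) ≠ 0 := by
    intro h0
    rw [map_eq_zero_iff _ (IsFractionRing.injective (MvPolynomial (Fin n) K) (RatFun K n))] at h0
    rw [h0, zero_mul] at hg
    exact vdm_ne_zero hg
  have hc (a : K) : algebraMap K (RatFun K n) a = algebraMap _ (RatFun K n)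
      (C a : MvPolynomial (Fin n) K) := by
    rw [IsScalarTower.algebraMap_apply K (MvPolynomial (Fin n) K) (RatFun K n)]
    rfl
  have hA : coeffA t I = algebraMap _ (RatFun K n)
      (C (t ^ (I.card * (I.card - 1) / 2)) : MvPolynomial (Fin n) K) *
      (algebraMap _ (RatFun K n)
        (∏ p ∈ I ×ˢ Iᶜ, (C t * X p.1 - X p.2 : MvPolynomial (Fin n) K)) /
      algebraMap _ (RatFun K n)
        (∏ p ∈ I ×ˢ Iᶜ, (X p.1 - X p.2 : MvPolynomial (Fin n) K))) := by
    rw [coeffA, hc, ← Finset.prod_product', map_prod, map_prod, ← Finset.prod_div_distrib]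
    congr 1
    refine Finset.prod_congr rfl fun p _ => ?_
    rw [Algebra.smul_def, hc, map_sub, map_sub, map_mul]
    rfl
  rw [hA, hg, map_mul, map_mul, map_mul]
  field_simp

theorem ratD_mem [CharZero K] (q t : K) (r : ℕ) (f : SymPoly K n) :
    ∃ g : SymPoly K n, algebraMap (MvPolynomial (Fin n) K) (RatFun K n) g = ratD q t n r f := by
  have hinj := IsFractionRing.injective (MvPolynomial (Fin n) K) (RatFun K n)
  have hf : (f : MvPolynomial (Fin n) K).IsSymmetric := f.2
  choose u hu using fun I : Finset (Fin n) => vdm_mul_coeffA (K := K) t I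
  set h : MvPolynomial (Fin n) K :=
    ∑ I ∈ Finset.powersetCard r (Finset.univ : Finset (Fin n)),
      u I * shift q I (f : MvPolynomial (Fin n) K) with hh
  have hV : algebraMap _ (RatFun K n) (vdm K n) * ratD q t n r f = algebraMap _ _ h := by
    rw [ratD_apply, hh, Finset.mul_sum, map_sum]
    refine Finset.sum_congr rfl fun I _ => ?_
    rw [← mul_assoc, hu, map_mul]
  have hanti : ∀ i j : Fin n, i ≠ j → rename (Equiv.swap i j) h = - h := by
    intro i j hij
    apply hinj
    rw [← permRat_algebraMap, ← hV, map_mul, permRat_ratD q t r _ _ hf, permRat_algebraMap,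
      rename_swap_vdm hij, map_neg, map_neg, ← hV, neg_mul]
  obtain ⟨g, hg⟩ := vdm_dvd h hanti
  have hgD : algebraMap (MvPolynomial (Fin n) K) (RatFun K n) g = ratD q t n r f := by
    have hne : algebraMap _ (RatFun K n) (vdm K n) ≠ 0 := fun h0 =>
      vdm_ne_zero ((map_eq_zero_iff _ hinj).1 h0)
    refine mul_left_cancel₀ hne ?_
    rw [hV, hg, map_mul]
  refine ⟨⟨g, fun σ => hinj ?_⟩, hgD⟩
  rw [← permRat_algebraMap, hgD, permRat_ratD q t r σ _ hf]

/-- The inclusion of `Λ_n` into the rational functions. -/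
noncomputable def toRatFun (K : Type*) [Field K] (n : ℕ) : SymPoly K n →ₗ[K] RatFun K n :=
  (IsScalarTower.toAlgHom K (MvPolynomial (Fin n) K) (RatFun K n)).toLinearMap ∘ₗ
    (SymPoly K n).val.toLinearMap

theorem toRatFun_injective : Function.Injective (toRatFun K n) := fun _ _ h =>
  Subtype.ext (IsFractionRing.injective (MvPolynomial (Fin n) K) (RatFun K n) h)

/-- The Macdonald operator `D_n^r` on `Λ_n`: `opD q t n r f` is the symmetric polynomial that
equals the rational function `ratD q t n r f`. -/
noncomputable def opD [CharZero K] (q t : K) (n r : ℕ) : Module.End K (SymPoly K n) :=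
  (LinearEquiv.ofInjective (toRatFun K n) toRatFun_injective).symm.toLinearMap ∘ₗ
    LinearMap.codRestrict (LinearMap.range (toRatFun K n))
      (ratD q t n r ∘ₗ (SymPoly K n).val.toLinearMap) (fun f => ratD_mem q t r f)

theorem algebraMap_opD [CharZero K] (q t : K) (n r : ℕ) (f : SymPoly K n) :
    algebraMap (MvPolynomial (Fin n) K) (RatFun K n) (opD q t n r f) = ratD q t n r f := by
  obtain ⟨g, hg⟩ := ratD_mem q t r f
  have h := LinearEquiv.apply_symm_apply
    (LinearEquiv.ofInjective (toRatFun K n) toRatFun_injective)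
    (LinearMap.codRestrict (LinearMap.range (toRatFun K n))
      (ratD q t n r ∘ₗ (SymPoly K n).val.toLinearMap) (fun f => ratD_mem q t r f) f)
  exact congrArg Subtype.val h

/-! ### The modified operators -/

/-- `e_j(y_0, …, y_{N-1})`. -/
noncomputable def esymmFirst (y : ℕ → K) (N j : ℕ) : K :=
  ((Multiset.range N).map y).esymm j

/-- `(-1)^j t^{(j²-3j)/2}`; the exponent is an integer, as `j² - 3j` is even. -/
noncomputable def prefactor (t : K) (j : ℕ) : K :=
  (-1) ^ j * t ^ (((j : ℤ) ^ 2 - 3 * j) / 2)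

/-- `E_n^r = ∑_{j=0}^r (-1)^j t^{(j²-3j)/2} e_j(1, t⁻¹, …, t^{-(n+j-2)}) t^{-(r-j)n} D_n^{r-j}`. -/
noncomputable def opE [CharZero K] (q t : K) (n r : ℕ) : Module.End K (SymPoly K n) :=
  ∑ j ∈ Finset.range (r + 1),
    (prefactor t j * esymmFirst (fun i => t⁻¹ ^ i) (n + j - 1) j * t⁻¹ ^ ((r - j) * n)) •
      opD q t n (r - j)

/-- Setting the last variable equal to zero, `K[x_1, …, x_{n+1}] → K[x_1, …, x_n]`. -/
noncomputable def killLast (K : Type*) [Field K] (n : ℕ) :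
    MvPolynomial (Fin (n + 1)) K →ₐ[K] MvPolynomial (Fin n) K :=
  aeval (Fin.lastCases 0 X)

theorem killLast_isSymmetric (f : MvPolynomial (Fin (n + 1)) K) (hf : f.IsSymmetric) :
    (killLast K n f).IsSymmetric := by
  intro σ
  let τ : Equiv.Perm (Fin (n + 1)) :=
    (finSuccEquivLast (n := n)).trans ((Equiv.optionCongr σ).trans finSuccEquivLast.symm)
  conv_rhs => rw [← hf τ]
  rw [killLast, aeval_rename, ← AlgHom.comp_apply]
  congr 1
  ext i : 1
  refine Fin.lastCases ?_ (fun i => ?_) i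
  · simp [τ]
  · simp [τ]

/-- The restriction `Λ_{n+1} → Λ_n`, `f ↦ f|_{x_{n+1} = 0}`. -/
noncomputable def res (K : Type*) [Field K] (n : ℕ) : SymPoly K (n + 1) →ₐ[K] SymPoly K n :=
  ((killLast K n).comp (SymPoly K (n + 1)).val).codRestrict (SymPoly K n)
    fun f => killLast_isSymmetric f.1 f.2

/-! ### Symmetric functions in infinitely many variables -/

/-- The ring `Λ` of symmetric functions over `K`: sequences of symmetric polynomials `f_n ∈ Λ_n`
of bounded degree, with `f_{n+1}|_{x_{n+1} = 0} = f_n`. -/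
noncomputable def SymFun (K : Type*) [Field K] : Subalgebra K (∀ n, SymPoly K n) where
  carrier := {f | (∀ n, res K n (f (n + 1)) = f n) ∧
    ∃ d : ℕ, ∀ n, (f n : MvPolynomial (Fin n) K).totalDegree ≤ d}
  mul_mem' := by
    rintro f g ⟨hf, d, hd⟩ ⟨hg, e, he⟩
    refine ⟨fun n => by rw [Pi.mul_apply, map_mul, hf, hg]; rfl, d + e, fun n => ?_⟩
    exact (totalDegree_mul _ _).trans (add_le_add (hd n) (he n))
  add_mem' := by
    rintro f g ⟨hf, d, hd⟩ ⟨hg, e, he⟩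
    refine ⟨fun n => by rw [Pi.add_apply, map_add, hf, hg]; rfl, max d e, fun n => ?_⟩
    exact (totalDegree_add _ _).trans (max_le_max (hd n) (he n))
  algebraMap_mem' := by
    intro c
    refine ⟨fun n => by simp, 0, fun n => ?_⟩
    exact (totalDegree_C c).le

/-- The specialization `f ↦ f(x_1, …, x_n, 0, 0, …)`, `Λ → Λ_n`. -/
noncomputable def toVars (K : Type*) [Field K] (n : ℕ) : SymFun K →ₐ[K] SymPoly K n :=
  (Pi.evalAlgHom K (fun n => SymPoly K n) n).comp (SymFun K).val

/-- The Newton power sum `p_k = x_1^k + x_2^k + ⋯` for `k ≥ 1`. -/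
noncomputable def powerSum (K : Type*) [Field K] (k : ℕ) (hk : 0 < k) : SymFun K :=
  ⟨fun n => ⟨psum (Fin n) K k, psum_isSymmetric (Fin n) K k⟩, by
    refine ⟨fun n => Subtype.ext ?_, k, fun n => ?_⟩
    · show killLast K n (psum (Fin (n + 1)) K k) = psum (Fin n) K k
      simp [killLast, psum, Fin.sum_univ_castSucc, hk.ne']
    · refine (totalDegree_finsetSum _ _).trans (Finset.sup_le fun i _ => ?_)
      exact (totalDegree_pow _ _).trans (by simp)⟩

/-! ### Partitions and Macdonald functions -/

/-- Partitions of arbitrary size. -/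
abbrev Ptn : Type := Σ d : ℕ, Nat.Partition d

/-- The part `μ_{i+1}` of a partition (the index `i` starts at `0`), zero for large `i`. -/
def Ptn.part (μ : Ptn) (i : ℕ) : ℕ := (μ.2.parts.sort (· ≥ ·)).getD i 0

/-- The length `ℓ(μ)`. -/
def Ptn.length (μ : Ptn) : ℕ := μ.2.parts.card

/-- `z_λ = ∏_{i ≥ 1} i^{m_i} m_i!`, with `m_i` the multiplicity of `i` in `λ`. -/
def Ptn.z (lam : Ptn) : ℕ :=
  ∏ i ∈ lam.2.parts.toFinset, i ^ lam.2.parts.count i * (lam.2.parts.count i).factorial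

/-- The strict dominance order: `μ < λ` iff `|μ| = |λ|`, `μ ≠ λ` and
`μ_1 + ⋯ + μ_k ≤ λ_1 + ⋯ + λ_k` for all `k`. -/
def Dominated {d : ℕ} (μ lam : Nat.Partition d) : Prop :=
  μ ≠ lam ∧ ∀ k : ℕ, ∑ i ∈ Finset.range k, Ptn.part ⟨d, μ⟩ i ≤
    ∑ i ∈ Finset.range k, Ptn.part ⟨d, lam⟩ i

/-- `p_λ = ∏_i p_{λ_i}`. -/
noncomputable def powerSumPart (K : Type*) [Field K] (lam : Ptn) : SymFun K :=
  (lam.2.parts.attach.map fun k => powerSum K k.1 (lam.2.parts_pos k.2)).prod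

/-- `(p_λ, p_λ)_{q,t} = z_λ ∏_i (1 - q^{λ_i}) / (1 - t^{λ_i})`. -/
noncomputable def normP (q t : K) (lam : Ptn) : K :=
  lam.z * (lam.2.parts.map fun k => (1 - q ^ k) / (1 - t ^ k)).prod

/-- The coordinates of a symmetric function in the basis `(p_λ)` of `Λ`. -/
noncomputable def powerSumCoords (f : SymFun K) : Ptn →₀ K :=
  Function.invFun (Finsupp.linearCombination K (powerSumPart K)) f

/-- The scalar product `(f, g)_{q,t}`, i.e. the bilinear form on `Λ` with
`(p_λ, p_μ)_{q,t} = δ_{λμ} z_λ ∏_i (1 - q^{λ_i}) / (1 - t^{λ_i})`. -/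
noncomputable def scalarProduct (q t : K) (f g : SymFun K) : K :=
  (powerSumCoords f).sum fun lam a => a * powerSumCoords g lam * normP q t lam

/-- `P` is the family of Macdonald functions `P_λ(x; q, t)`:
`P_λ = m_λ + ∑_{μ < λ} u_{λμ} m_μ` (an identity in `Λ`, i.e. in any number `n` of variables
with coefficients that do not depend on `n`), and the `P_λ` are pairwise orthogonal. -/
structure IsMacdonald (q t : K) (P : Ptn → SymFun K) : Prop where
  triangular : ∀ (d : ℕ) (lam : Nat.Partition d), ∃ u : Nat.Partition d → K,
    (∀ μ, u μ ≠ 0 → Dominated μ lam) ∧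
    ∀ n, (toVars K n (P ⟨d, lam⟩) : MvPolynomial (Fin n) K) =
      msymm (Fin n) K lam + ∑ μ, u μ • msymm (Fin n) K μ
  orthogonal : ∀ lam μ : Ptn, lam ≠ μ → scalarProduct q t (P lam) (P μ) = 0

/-! ### Eigenvalues -/

/-- The numbers `q^{μ_i} t^{-i}`, `i = 1, 2, …` (with the index shifted by one). -/
noncomputable def spec (q t : K) (μ : Ptn) (i : ℕ) : K := q ^ μ.part i * t⁻¹ ^ (i + 1)

/-- `e_n^r(μ)`, the eigenvalue of `E_n^r`. -/
noncomputable def eigE (q t : K) (n r : ℕ) (μ : Ptn) : K :=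
  ∑ j ∈ Finset.range (r + 1),
    prefactor t j * esymmFirst (fun i => t⁻¹ ^ i) (n + j - 1) j *
      esymmFirst (spec q t μ) n (r - j)

/-- `a = e_j(y_0, y_1, y_2, …)`, as a limit of the elementary symmetric polynomials in finitely
many of the variables. -/
def IsEsymmInf [TopologicalSpace K] (y : ℕ → K) (j : ℕ) (a : K) : Prop :=
  Filter.Tendsto (fun N => esymmFirst y N j) Filter.atTop (nhds a)

end Macdonald
end

/-! Let Δ be the Vandermonde determinant and let T_{u,I} multiply the variables in I by u.
Everything rests on A_I = T_{t,I}Δ / Δ, which gives the polynomial identity Δ · D_n^r f = ∑_{|I| =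
r} (T_{t,I}Δ)(T_{q,I}f) (`vdm_mul_opD`).

Stability: setting the last variable to zero turns Δ into ∏(-x_i) times the smaller Δ, so
D_{n+1}^{k+1} restricts to t^{k+1} D_n^{k+1} + t^k D_n^k (`res_opD_succ`). In generating series, the
rescaled operators t^{-kn} D_n^k gain a factor 1 + t^{-(n+1)} z when n + 1 is replaced by n, and the
coefficients of E_n^r compensate for exactly that factor (`coeffE_succ`, `sum_convolution_eq`).
Degrees do not grow, so the E_n^r glue to an operator E^r on Λ (`limE`).

Self-adjointness (`scalarForm_limE_comm`): the operators in x and in y agree on the kernel ∑ (p_λ,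
p_λ)⁻¹ p_λ(x) p_λ(y). There T_{q,I} acts by the factor ∏_{i ∈ I, j} (1 - x_i y_j)/(1 - t x_i y_j),
and the resulting identity follows from the Cauchy determinant: in the Leibniz expansion of det
(1/(1 - x_i y_j)), scaling r rows or r columns by t gives the same sum (`sum_det_scale`).

Triangularity (`coeff_opE`): E_n^r does not raise the lexicographic leading exponent, and multiplies
the coefficient at μ by e_n^r(μ). The lexicographic order refines dominance, so P_μ has leading
monomial x^μ, and the P_μ span Λ.

Consequently E^r P_λ - e(λ) P_λ is orthogonal to every P_μ: if μ ≥ λ because its leading exponent is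
below λ, if μ < λ by moving E^r to P_μ. The form is nondegenerate, so the difference vanishes
(`IsMacdonald.limE_apply`). Distinctness of eigenvalues plays no role, so special q and t are
allowed.

For the last formula, e_n^r(μ) is constant for n ≥ ℓ(μ). The e_j(1, t⁻¹, …) converge by a recursion
in j, and constancy of the eigenvalues then forces convergence of the e_k(q^{μ_i} t^{-i}). -/

namespace Macdonald
open Finset

/-! ### The Macdonald operators through the Vandermonde determinant -/

/-- The pairs `(i, j)` of indices with `j < i`. -/
def descPairs (n : ℕ) : Finset (Fin n × Fin n) := univ.filter fun p => p.2 < p.1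

/-- Each off-diagonal pair is descending or the swap of a descending one. This compares products
over the factors of Δ with products over I × Iᶜ. -/
theorem prod_descPairs_mul_swap {M : Type*} [CommMonoid M] {n : ℕ} (b : Fin n × Fin n → M)
    (hb : ∀ i, b (i, i) = 1) :
    ∏ p ∈ descPairs n, b p * b p.swap = ∏ p, b p := by
  have h1 : ∏ p ∈ descPairs n, b p.swap = ∏ p ∈ univ.filter (fun p : Fin n × Fin n => p.1 < p.2), b p := by
    refine prod_bij' (fun p _ => p.swap) (fun p _ => p.swap) ?_ ?_ ?_ ?_ ?_ <;> simp [descPairs]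
  rw [prod_mul_distrib, h1,
    ← prod_filter_mul_prod_filter_not univ (fun p : Fin n × Fin n => p.2 < p.1)]
  congr 1
  rw [← prod_filter_mul_prod_filter_not (univ.filter fun p : Fin n × Fin n => ¬ p.2 < p.1)
    (fun p : Fin n × Fin n => p.1 < p.2)]
  rw [prod_eq_one (s := filter (fun p : Fin n × Fin n => ¬ p.1 < p.2) _), mul_one]
  · refine prod_congr ?_ fun _ _ => rfl
    ext p
    simp only [mem_filter, mem_univ, true_and]
    exact ⟨fun h => ⟨h.le.not_gt, h⟩, fun h => h.2⟩
  · rintro ⟨i, j⟩ hp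
    simp only [mem_filter, mem_univ, true_and] at hp
    obtain rfl : i = j := le_antisymm (not_lt.1 hp.1) (not_lt.1 hp.2)
    exact hb i

theorem card_descPairs_filter {n : ℕ} (I : Finset (Fin n)) :
    ((descPairs n).filter fun p => p.1 ∈ I ∧ p.2 ∈ I).card = I.card * (I.card - 1) / 2 := by
  -- In `Multiplicative ℕ` the product lemma becomes a count: both orientations of a pair inside I
  -- are counted, giving |I|(|I| - 1).
  have h := prod_descPairs_mul_swap (M := Multiplicative ℕ)
    (fun p => Multiplicative.ofAdd (if p.1 ∈ I ∧ p.2 ∈ I ∧ p.1 ≠ p.2 then 1 else 0)) (by simp)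
  have h' : ∑ p ∈ descPairs n, ((if p.1 ∈ I ∧ p.2 ∈ I ∧ p.1 ≠ p.2 then 1 else 0) +
      (if p.2 ∈ I ∧ p.1 ∈ I ∧ p.2 ≠ p.1 then 1 else 0)) =
      ∑ p : Fin n × Fin n, if p.1 ∈ I ∧ p.2 ∈ I ∧ p.1 ≠ p.2 then 1 else 0 := h
  rw [← card_filter, show (univ.filter fun p : Fin n × Fin n => p.1 ∈ I ∧ p.2 ∈ I ∧ p.1 ≠ p.2)
    = I.offDiag by ext; simp [mem_offDiag], offDiag_card] at h'
  have h2 : ∑ p ∈ descPairs n, ((if p.1 ∈ I ∧ p.2 ∈ I ∧ p.1 ≠ p.2 then 1 else 0) +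
      (if p.2 ∈ I ∧ p.1 ∈ I ∧ p.2 ≠ p.1 then 1 else 0)) =
      ∑ p ∈ descPairs n, (if p.1 ∈ I ∧ p.2 ∈ I then 2 else 0) := by
    refine sum_congr rfl fun p hp => ?_
    have : p.1 ≠ p.2 := by simp only [descPairs, mem_filter] at hp; exact hp.2.ne'
    have h3 := this.symm
    by_cases h1 : p.1 ∈ I <;> by_cases h2 : p.2 ∈ I <;> simp [*]
  rw [h2, ← sum_filter, sum_const, smul_eq_mul] at h'
  rw [Nat.mul_sub, mul_one, ← h', Nat.mul_div_cancel _ two_pos]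

/-- Compare the factors of T_{t,I}Δ and Δ pair by pair. Two indices in I contribute t, none
contributes 1, and exactly one, say i ∈ I and j ∉ I, contributes (t x_i - x_j)/(x_i - x_j), whose
value does not depend on the orientation of the pair. -/
theorem prod_descPairs_scale {F : Type*} [Field F] {n : ℕ} (x : Fin n → F)
    (hx : Function.Injective x) (t : F) (I : Finset (Fin n)) :
    ∏ p ∈ descPairs n, ((if p.1 ∈ I then t * x p.1 else x p.1) -
        (if p.2 ∈ I then t * x p.2 else x p.2)) =
      (∏ p ∈ descPairs n, (x p.1 - x p.2)) * (t ^ (I.card * (I.card - 1) / 2) *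
        ∏ i ∈ I, ∏ j ∈ Iᶜ, (t * x i - x j) / (x i - x j)) := by
  have hb := prod_descPairs_mul_swap (fun p : Fin n × Fin n =>
    if p ∈ I ×ˢ Iᶜ then (t * x p.1 - x p.2) / (x p.1 - x p.2) else 1) (by simp)
  rw [← prod_product', ← card_descPairs_filter, ← prod_const, prod_filter]
  rw [prod_ite_mem, univ_inter] at hb
  rw [← hb, ← prod_mul_distrib, ← prod_mul_distrib]
  refine prod_congr rfl fun p hp => ?_
  have hne : x p.1 - x p.2 ≠ 0 := by
    simp only [descPairs, mem_filter] at hp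
    exact sub_ne_zero.2 (hx.ne hp.2.ne')
  have hne' : x p.2 - x p.1 ≠ 0 := by rw [← neg_sub]; exact neg_ne_zero.2 hne
  by_cases h1 : p.1 ∈ I <;> by_cases h2 : p.2 ∈ I <;> simp [h1, h2]
  · ring
  · field_simp
  · rw [← neg_sub (x p.2), neg_mul, mul_div_cancel₀ _ hne', neg_sub]

variable {K : Type*} [Field K] {n : ℕ}

theorem vdm_eq_prod : vdm K n = ∏ p ∈ descPairs n, (X p.1 - X p.2 : MvPolynomial (Fin n) K) := by
  rw [vdm, Matrix.det_vandermonde, Finset.prod_sigma']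
  refine Finset.prod_bij' (fun p _ => (p.2, p.1)) (fun p _ => ⟨p.2, p.1⟩) ?_ ?_ ?_ ?_ ?_ <;>
    simp [descPairs]

theorem algebraMap_shift_vdm (t : K) (I : Finset (Fin n)) :
    algebraMap _ (RatFun K n) (shift t I (vdm K n)) =
      algebraMap _ (RatFun K n) (vdm K n) * coeffA t I := by
  have hinj := IsFractionRing.injective (MvPolynomial (Fin n) K) (RatFun K n)
  have hx : Function.Injective (rx K : Fin n → RatFun K n) := fun i j h => X_injective (hinj h)
  have h := prod_descPairs_scale (rx K) hx (algebraMap K (RatFun K n) t) I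
  simp only [coeffA, Algebra.smul_def]
  rw [map_pow, vdm_eq_prod, map_prod, map_prod, map_prod]
  simp only [rx] at h ⊢
  simp only [map_sub]
  rw [← h]
  refine prod_congr rfl fun p _ => ?_
  have hc : algebraMap K (RatFun K n) t = algebraMap _ (RatFun K n)
      (C t : MvPolynomial (Fin n) K) := by
    rw [IsScalarTower.algebraMap_apply K (MvPolynomial (Fin n) K) (RatFun K n)]
    rfl
  rw [hc, shift, aeval_X, aeval_X]
  by_cases h1 : p.1 ∈ I <;> by_cases h2 : p.2 ∈ I <;> simp [h1, h2]

/-- Clearing denominators in the definition of the Macdonald operator `D_n^r`. -/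
theorem vdm_mul_opD [CharZero K] (q t : K) (r : ℕ) (f : SymPoly K n) :
    vdm K n * (opD q t n r f : MvPolynomial (Fin n) K) =
      ∑ I ∈ powersetCard r univ, shift t I (vdm K n) * shift q I (f : MvPolynomial (Fin n) K) := by
  apply IsFractionRing.injective (MvPolynomial (Fin n) K) (RatFun K n)
  rw [map_mul, algebraMap_opD, ratD_apply, mul_sum, map_sum]
  refine sum_congr rfl fun I _ => ?_
  rw [map_mul, algebraMap_shift_vdm, mul_assoc]

/-! ### Scaling of variables on monomials, and degree bounds -/

theorem shift_monomial (q : K) (I : Finset (Fin n)) (α : Fin n →₀ ℕ) (a : K) :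
    shift q I (monomial α a) = monomial α (q ^ (∑ i ∈ I, α i) * a) := by
  rw [shift, aeval_monomial, Finsupp.prod_fintype _ _ (by simp), monomial_eq (a := _ * a),
    Finsupp.prod_fintype _ _ (by simp), algebraMap_eq, C_mul, ← prod_pow_eq_pow_sum, map_prod,
    ← prod_filter_mul_prod_filter_not univ (· ∈ I) (fun i => (X i : MvPolynomial (Fin n) K) ^ α i),
    ← prod_filter_mul_prod_filter_not univ (· ∈ I)]
  have h1 : ∏ i ∈ univ.filter (· ∈ I), (if i ∈ I then C q * X i else X i : MvPolynomial (Fin n) K) ^ α i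
      = (∏ i ∈ I, C (q ^ α i)) * ∏ i ∈ univ.filter (· ∈ I), X i ^ α i := by
    rw [filter_mem_eq_inter, univ_inter, ← prod_mul_distrib]
    exact prod_congr rfl fun i hi => by rw [if_pos hi, mul_pow, C_pow]
  have h2 : ∏ i ∈ univ.filter (¬ · ∈ I), (if i ∈ I then C q * X i else X i : MvPolynomial (Fin n) K) ^ α i
      = ∏ i ∈ univ.filter (¬ · ∈ I), X i ^ α i :=
    prod_congr rfl fun i hi => by rw [if_neg (mem_filter.1 hi).2]
  rw [h1, h2]
  ring

/-- Scaling is diagonal on monomials. Hence it shrinks supports, so it raises neither the total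
degree nor any monomial-order degree. -/
theorem coeff_shift (q : K) (I : Finset (Fin n)) (α : Fin n →₀ ℕ) (f : MvPolynomial (Fin n) K) :
    coeff α (shift q I f) = q ^ (∑ i ∈ I, α i) * coeff α f := by
  induction f using MvPolynomial.induction_on' with
  | monomial β a =>
    rw [shift_monomial, coeff_monomial, coeff_monomial]
    split_ifs with h
    · rw [h]
    · simp
  | add f g hf hg => rw [map_add, coeff_add, hf, hg, coeff_add, mul_add]

theorem support_shift_subset (q : K) (I : Finset (Fin n)) (f : MvPolynomial (Fin n) K) :
    (shift q I f).support ⊆ f.support := by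
  intro α hα
  rw [mem_support_iff, coeff_shift] at hα
  exact mem_support_iff.2 (right_ne_zero_of_mul hα)

theorem totalDegree_shift_le (q : K) (I : Finset (Fin n)) (f : MvPolynomial (Fin n) K) :
    (shift q I f).totalDegree ≤ f.totalDegree :=
  totalDegree_le_of_support_subset (support_shift_subset q I f)

/-- Δ · D_n^r f has degree at most deg Δ + deg f, and degrees add over a domain, so Δ can be
cancelled. This bound keeps the limit operator inside Λ. -/
theorem totalDegree_opD_le [CharZero K] (q t : K) (r : ℕ) (f : SymPoly K n) :
    (opD q t n r f : MvPolynomial (Fin n) K).totalDegree ≤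
      (f : MvPolynomial (Fin n) K).totalDegree := by
  by_cases h0 : (opD q t n r f : MvPolynomial (Fin n) K) = 0
  · simp [h0]
  have h := totalDegree_mul_of_isDomain (vdm_ne_zero (K := K) (n := n)) h0
  rw [vdm_mul_opD] at h
  have h2 : (∑ I ∈ powersetCard r univ, shift t I (vdm K n) *
      shift q I (f : MvPolynomial (Fin n) K)).totalDegree ≤
      (vdm K n).totalDegree + (f : MvPolynomial (Fin n) K).totalDegree := by
    refine totalDegree_finsetSum_le fun I _ => (totalDegree_mul _ _).trans ?_
    exact add_le_add (totalDegree_shift_le _ _ _) (totalDegree_shift_le _ _ _)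
  omega

theorem totalDegree_opE_le [CharZero K] (q t : K) (r : ℕ) (f : SymPoly K n) :
    (opE q t n r f : MvPolynomial (Fin n) K).totalDegree ≤
      (f : MvPolynomial (Fin n) K).totalDegree := by
  rw [opE, LinearMap.sum_apply, AddSubmonoidClass.coe_finsetSum]
  refine totalDegree_finsetSum_le fun j _ => ?_
  rw [LinearMap.smul_apply, SetLike.val_smul]
  exact (totalDegree_smul_le _ _).trans (totalDegree_opD_le _ _ _ _)

/-! ### Stability -/

theorem killLast_vdm : killLast K n (vdm K (n + 1)) = (∏ i, -X i) * vdm K n := by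
  rw [vdm, vdm, Matrix.det_vandermonde, Matrix.det_vandermonde, map_prod]
  simp only [map_prod, map_sub]
  rw [Fin.prod_univ_castSucc]
  simp only [killLast, aeval_X, Fin.lastCases_castSucc]
  rw [← prod_mul_distrib]
  have h0 : Finset.Ioi (Fin.last n) = ∅ := by ext; simp [Fin.le_last]
  rw [h0, prod_empty, mul_one]
  refine prod_congr rfl fun i _ => ?_
  have hI : Finset.Ioi i.castSucc = insert (Fin.last n) ((Finset.Ioi i).map Fin.castSuccEmb) := by
    ext j
    refine Fin.lastCases ?_ (fun j => ?_) j
    · simp [Fin.castSucc_lt_last]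
    · simp [Fin.le_last]
  rw [hI, prod_insert (by simp), prod_map]
  simp

/-- The indices of `I` other than the last one. -/
def dropLast (I : Finset (Fin (n + 1))) : Finset (Fin n) := univ.filter fun i => i.castSucc ∈ I

theorem killLast_shift (q : K) (I : Finset (Fin (n + 1))) (f : MvPolynomial (Fin (n + 1)) K) :
    killLast K n (shift q I f) = shift q (dropLast I) (killLast K n f) := by
  rw [← AlgHom.comp_apply, ← AlgHom.comp_apply]
  congr 1
  ext i : 1
  refine Fin.lastCases ?_ (fun i => ?_) i
  · by_cases h : Fin.last n ∈ I <;> simp [killLast, shift, h]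
  · by_cases h : i.castSucc ∈ I <;> simp [killLast, shift, dropLast, h]

theorem shift_prod_neg_X (t : K) (I : Finset (Fin n)) :
    shift t I (∏ i, -X i) = C (t ^ I.card) * ∏ i, -X i := by
  rw [map_prod, ← prod_const, map_prod, ← univ_inter I, ← prod_ite_mem, ← prod_mul_distrib]
  refine prod_congr rfl fun i _ => ?_
  by_cases h : i ∈ I <;> simp [shift, h]

/-- Split according to whether the last index lies in the set: without it r + 1 other indices
remain, with it only r. -/
theorem sum_powersetCard_dropLast {M : Type*} [AddCommMonoid M] (r : ℕ) (g : Finset (Fin n) → M) :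
    ∑ I ∈ powersetCard (r + 1) (univ : Finset (Fin (n + 1))), g (dropLast I) =
      ∑ I ∈ powersetCard (r + 1) univ, g I + ∑ I ∈ powersetCard r univ, g I := by
  have hu : (univ : Finset (Fin (n + 1))) = insert (Fin.last n) (univ.map Fin.castSuccEmb) := by
    ext j
    refine Fin.lastCases ?_ (fun j => ?_) j <;> simp
  have hd1 (I : Finset (Fin n)) : dropLast (I.map Fin.castSuccEmb) = I := by
    ext; simp [dropLast]
  have hd2 (I : Finset (Fin n)) : dropLast (insert (Fin.last n) (I.map Fin.castSuccEmb)) = I := by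
    ext; simp [dropLast, Fin.castSucc_ne_last]
  have hn : ∀ I : Finset (Fin n), Fin.last n ∉ I.map Fin.castSuccEmb := by
    simp [Fin.castSucc_ne_last]
  rw [hu, powersetCard_succ_insert (hn _), sum_union, sum_image]
  · simp only [powersetCard_map, sum_map, RelEmbedding.coe_toEmbedding, mapEmbedding_apply, hd1, hd2]
  · intro A hA B hB h
    simp only [powersetCard_map, coe_map, Set.mem_image] at hA hB
    obtain ⟨A, _, rfl⟩ := hA
    obtain ⟨B, _, rfl⟩ := hB
    have := congrArg dropLast h
    simp only [RelEmbedding.coe_toEmbedding, mapEmbedding_apply, hd2] at this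
    rw [this]
  · rw [disjoint_left]
    intro A hA hB
    obtain ⟨B, _, rfl⟩ := mem_image.1 hB
    rw [powersetCard_map, mem_map] at hA
    obtain ⟨C, _, hC⟩ := hA
    have h := mem_insert_self (Fin.last n) B
    rw [← hC] at h
    exact hn _ h

theorem prod_neg_X_ne_zero : (∏ i : Fin n, -X i : MvPolynomial (Fin n) K) ≠ 0 :=
  prod_ne_zero_iff.2 fun i _ => neg_ne_zero.2 (X_ne_zero i)

theorem coe_res (f : SymPoly K (n + 1)) :
    (res K n f : MvPolynomial (Fin n) K) = killLast K n (f : MvPolynomial (Fin (n + 1)) K) := rfl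

theorem shift_empty (q : K) : shift q (∅ : Finset (Fin n)) = AlgHom.id K _ := by
  ext; simp [shift]

theorem opD_zero [CharZero K] (q t : K) : opD q t n 0 = 1 := by
  ext f : 1
  refine Subtype.ext (mul_left_cancel₀ (vdm_ne_zero (K := K) (n := n)) ?_)
  rw [vdm_mul_opD]
  simp [shift_empty]

/-- After x_{n+1} = 0 a set I matters only through its trace on the first n indices. Scaling the
extra factor ∏(-x_i) of the Vandermonde yields t to the size of that trace, which is r + 1 or r. -/
theorem res_opD_succ [CharZero K] (q t : K) (r : ℕ) (f : SymPoly K (n + 1)) :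
    res K n (opD q t (n + 1) (r + 1) f) =
      t ^ (r + 1) • opD q t n (r + 1) (res K n f) + t ^ r • opD q t n r (res K n f) := by
  refine Subtype.ext (mul_left_cancel₀ (mul_ne_zero prod_neg_X_ne_zero
    (vdm_ne_zero (K := K) (n := n))) ?_)
  rw [coe_res, ← killLast_vdm, ← map_mul, vdm_mul_opD, map_sum]
  have h1 (I : Finset (Fin (n + 1))) : killLast K n (shift t I (vdm K (n + 1)) *
      shift q I (f : MvPolynomial (Fin (n + 1)) K)) =
      (∏ i, -X i) * (C (t ^ (dropLast I).card) * (shift t (dropLast I) (vdm K n) *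
        shift q (dropLast I) (res K n f : MvPolynomial (Fin n) K))) := by
    rw [map_mul, killLast_shift, killLast_shift, killLast_vdm, map_mul, shift_prod_neg_X, coe_res]
    ring
  rw [sum_congr rfl fun I _ => h1 I, ← mul_sum, sum_powersetCard_dropLast (g := fun I =>
    C (t ^ I.card) * (shift t I (vdm K n) * shift q I (res K n f : MvPolynomial (Fin n) K)))]
  have h2 (k : ℕ) : ∑ I ∈ powersetCard k univ, C (t ^ I.card) * (shift t I (vdm K n) *
      shift q I (res K n f : MvPolynomial (Fin n) K)) =
      vdm K n * (t ^ k • (opD q t n k (res K n f) : MvPolynomial (Fin n) K)) := by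
    rw [smul_eq_C_mul, mul_left_comm, vdm_mul_opD, mul_sum]
    exact sum_congr rfl fun I hI => by rw [(mem_powersetCard.1 hI).2]
  rw [h2, h2, killLast_vdm, ← mul_add, ← mul_assoc]
  rfl

/-- The coefficient of `t^{-(r-j)n} D_n^{r-j}` in `E_n^r`. -/
noncomputable def coeffE (t : K) (n j : ℕ) : K :=
  prefactor t j * esymmFirst (fun i => t⁻¹ ^ i) (n + j - 1) j

theorem esymmFirst_zero (y : ℕ → K) (N : ℕ) : esymmFirst y N 0 = 1 := by
  simp [esymmFirst, Multiset.esymm]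

theorem esymmFirst_succ (y : ℕ → K) (N j : ℕ) :
    esymmFirst y (N + 1) (j + 1) = esymmFirst y N (j + 1) + y N * esymmFirst y N j := by
  simp only [esymmFirst, Multiset.esymm, Multiset.range_succ, Multiset.map_cons,
    Multiset.powersetCard_cons, Multiset.map_add, Multiset.sum_add, Multiset.map_map,
    Function.comp_def, Multiset.prod_cons]
  rw [Multiset.sum_map_mul_left]

theorem prefactor_succ {t : K} (ht0 : t ≠ 0) (j : ℕ) :
    t * prefactor t (j + 1) = -(t ^ j * prefactor t j) := by
  -- The numerators differ by 2(j - 1), so the integer quotients differ by exactly j - 1.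
  have h : (((j + 1 : ℕ) : ℤ) ^ 2 - 3 * ((j + 1 : ℕ) : ℤ)) / 2 = ((j : ℤ) ^ 2 - 3 * j) / 2 + j - 1 := by
    have : (((j + 1 : ℕ) : ℤ) ^ 2 - 3 * ((j + 1 : ℕ) : ℤ)) = ((j : ℤ) ^ 2 - 3 * j) + 2 * (j - 1) := by
      push_cast; ring
    omega
  rw [prefactor, prefactor, h, zpow_sub₀ ht0, zpow_add₀ ht0, zpow_natCast, zpow_one, pow_succ]
  field_simp

theorem coeffE_zero (t : K) (n : ℕ) : coeffE t n 0 = 1 := by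
  simp [coeffE, prefactor, esymmFirst_zero]

/-- The last argument of e_{j+1} contributes t^{-(n+j)} e_j, and the ratio of consecutive prefactors
is -t^{j-1}. Their product is -t^{-(n+1)}, which cancels the second summand. -/
theorem coeffE_succ {t : K} (ht0 : t ≠ 0) (n j : ℕ) :
    coeffE t (n + 1) (j + 1) + t⁻¹ ^ (n + 1) * coeffE t (n + 1) j = coeffE t n (j + 1) := by
  have h := prefactor_succ ht0 j
  have h' : prefactor t (j + 1) = -(t ^ j * prefactor t j) * t⁻¹ := by
    rw [← h]; field_simp
  -- No truncation occurs in these differences. The only truncated case of `n + j - 1` is n = j = 0,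
  -- where e_0 = 1 regardless.
  rw [coeffE, coeffE, coeffE, show n + 1 + (j + 1) - 1 = n + j + 1 by omega,
    show n + 1 + j - 1 = n + j by omega, show n + (j + 1) - 1 = n + j by omega, esymmFirst_succ, h']
  simp only [inv_pow]
  field_simp
  ring

/-- In generating series, b = (1 + vz) a and c = (1 + vz) c', hence c' b = c a. The statement is
module-valued because it serves both for the operators and for their eigenvalues. -/
theorem sum_convolution_eq {R V : Type*} [CommRing R] [AddCommGroup V] [Module R V] (v : R)
    (c c' : ℕ → R) (a b : ℕ → V) (hc0 : c 0 = c' 0) (hc : ∀ j, c' (j + 1) + v * c' j = c (j + 1))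
    (hb0 : b 0 = a 0) (hb : ∀ k, b (k + 1) = a (k + 1) + v • a k) (r : ℕ) :
    ∑ j ∈ range (r + 1), c' j • b (r - j) = ∑ j ∈ range (r + 1), c j • a (r - j) := by
  cases r with
  | zero => simp [hc0, hb0]
  | succ r =>
    rw [sum_range_succ, sum_range_succ' (fun j => c j • a (r + 1 - j))]
    have h1 : ∑ j ∈ range (r + 1), c' j • b (r + 1 - j) =
        ∑ j ∈ range (r + 1), c' j • a (r + 1 - j) + ∑ j ∈ range (r + 1), (v * c' j) • a (r - j) := by
      rw [← sum_add_distrib]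
      refine sum_congr rfl fun j hj => ?_
      rw [mem_range] at hj
      rw [show r + 1 - j = (r - j) + 1 by omega, hb, smul_add, smul_smul, mul_comm v]
    have h2 : ∑ j ∈ range (r + 1), c (j + 1) • a (r + 1 - (j + 1)) =
        ∑ j ∈ range (r + 1), c' (j + 1) • a (r + 1 - (j + 1)) +
          ∑ j ∈ range (r + 1), (v * c' j) • a (r - j) := by
      rw [← sum_add_distrib]
      refine sum_congr rfl fun j hj => ?_
      rw [← hc, add_smul, show r + 1 - (j + 1) = r - j by omega]
    rw [h1, h2, hc0]
    have h3 := sum_range_succ' (fun j => c' j • a (r + 1 - j)) (r + 1)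
    rw [sum_range_succ] at h3
    simp only [Nat.sub_self, Nat.sub_zero, hb0] at h3 ⊢
    rw [add_right_comm, h3]
    abel

theorem opE_apply [CharZero K] (q t : K) (r : ℕ) (f : SymPoly K n) :
    opE q t n r f = ∑ j ∈ range (r + 1), coeffE t n j •
      (t⁻¹ ^ ((r - j) * n) • opD q t n (r - j) f) := by
  simp [opE, coeffE, smul_smul]

theorem res_opE [CharZero K] (q : K) {t : K} (ht0 : t ≠ 0) (r : ℕ) (f : SymPoly K (n + 1)) :
    res K n (opE q t (n + 1) r f) = opE q t n r (res K n f) := by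
  rw [opE_apply, opE_apply, map_sum]
  simp only [map_smul]
  refine sum_convolution_eq (t⁻¹ ^ (n + 1)) (coeffE t n) (coeffE t (n + 1))
    (fun k => t⁻¹ ^ (k * n) • opD q t n k (res K n f))
    (fun k => t⁻¹ ^ (k * (n + 1)) • res K n (opD q t (n + 1) k f)) ?_ (coeffE_succ ht0 n) ?_ ?_ r
  · rw [coeffE_zero, coeffE_zero]
  · simp [opD_zero]
  · intro k
    rw [res_opD_succ, smul_add, smul_smul, smul_smul, smul_smul]
    congr 2
    · rw [mul_add, mul_one, pow_add, mul_assoc, ← mul_pow, inv_mul_cancel₀ ht0, one_pow, mul_one]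
    · rw [show (k + 1) * (n + 1) = (n + 1 + k * n) + k by ring, pow_add, mul_assoc, ← mul_pow,
        inv_mul_cancel₀ ht0, one_pow, mul_one, pow_add]

/-! ### The operator on symmetric functions -/

theorem SymFun.ext {f g : SymFun K} (h : ∀ n, toVars K n f = toVars K n g) : f = g :=
  Subtype.ext (funext h)

/-- The operator `E^r` on `Λ`. -/
noncomputable def limE [CharZero K] (q : K) {t : K} (ht0 : t ≠ 0) (r : ℕ) :
    Module.End K (SymFun K) where
  toFun f := ⟨fun n => opE q t n r (toVars K n f), by
    obtain ⟨hf, d, hd⟩ := f.2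
    refine ⟨fun n => ?_, d, fun n => (totalDegree_opE_le _ _ _ _).trans (hd n)⟩
    rw [res_opE q ht0]
    exact congrArg _ (hf n)⟩
  map_add' f g := SymFun.ext fun n => by
    show opE q t n r (toVars K n (f + g)) = opE q t n r (toVars K n f) + opE q t n r (toVars K n g)
    rw [map_add, map_add]
  map_smul' c f := SymFun.ext fun n => by
    show opE q t n r (toVars K n (c • f)) = c • opE q t n r (toVars K n f)
    rw [map_smul, map_smul]

theorem toVars_limE [CharZero K] (q : K) {t : K} (ht0 : t ≠ 0) (r n : ℕ) (f : SymFun K) :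
    toVars K n (limE q ht0 r f) = opE q t n r (toVars K n f) := rfl

end Macdonald

namespace Macdonald
open Finset

/-! ### Power sums form a basis -/

/-- The kernels of the iterates stabilise. If f x = 0 and x = fⁿ y, then y lies in the kernel of
f^{n+1}, hence in that of fⁿ, so x = 0. -/
theorem injective_of_surjective_ringEnd {R : Type*} [CommRing R] [IsNoetherianRing R] (f : R →+* R)
    (hf : Function.Surjective f) : Function.Injective f := by
  let g : ℕ →o Ideal R := ⟨fun n => RingHom.ker (f ^ n), monotone_nat_of_le_succ fun n x hx => by
    rw [RingHom.mem_ker] at hx ⊢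
    rw [pow_succ', RingHom.mul_def, RingHom.comp_apply, hx, map_zero]⟩
  obtain ⟨n, hn⟩ := monotone_stabilizes_iff_noetherian.2 ‹IsNoetherianRing R› g
  have hs : Function.Surjective (f ^ n : R →+* R) := by
    rw [RingHom.coe_pow]; exact hf.iterate n
  rw [injective_iff_map_eq_zero]
  intro x hx
  obtain ⟨y, rfl⟩ := hs x
  have h1 : y ∈ g (n + 1) := by
    show y ∈ RingHom.ker (f ^ (n + 1))
    rw [RingHom.mem_ker, pow_succ', RingHom.mul_def, RingHom.comp_apply, hx]
  rw [← hn (n + 1) (Nat.le_succ n)] at h1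
  exact h1

variable {K : Type*} [Field K] {n : ℕ}

theorem coe_toVars_powerSumPart (n : ℕ) (lam : Ptn) :
    (toVars K n (powerSumPart K lam) : MvPolynomial (Fin n) K) =
      (lam.2.parts.map (psum (Fin n) K)).prod := by
  have h : ∀ f : SymFun K, (toVars K n f : MvPolynomial (Fin n) K) =
    ((SymPoly K n).val.comp (toVars K n)) f := fun _ => rfl
  rw [h, powerSumPart, map_multiset_prod, Multiset.map_map]
  conv_rhs => rw [← Multiset.attach_map_val lam.2.parts, Multiset.map_map]
  rfl

/-- The homomorphism from the polynomial ring to `Λ_n` that sends the variables to the power sums. -/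
noncomputable def psumHom (K : Type*) [Field K] (n : ℕ) : MvPolynomial (Fin n) K →ₐ[K] SymPoly K n :=
  aeval fun i => ⟨psum (Fin n) K (i + 1), psum_isSymmetric _ _ _⟩

theorem coe_psumHom (g : MvPolynomial (Fin n) K) :
    (psumHom K n g : MvPolynomial (Fin n) K) = aeval (fun i : Fin n => psum (Fin n) K (i + 1)) g := by
  have : (SymPoly K n).val.comp (psumHom K n) = aeval (fun i : Fin n => psum (Fin n) K (i + 1)) := by
    ext i : 1
    simp [psumHom]
  exact congrArg (fun φ => φ g) this

/-- Newton's identities express k e_k through power sums and smaller e_i; characteristic 0 allows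
division by k. -/
theorem esymm_mem_range_psumHom [CharZero K] (k : ℕ) (hk : k ≤ n) :
    esymm (Fin n) K k ∈ ((SymPoly K n).val.comp (psumHom K n)).range := by
  induction k using Nat.strong_induction_on with
  | _ k ih =>
    rcases Nat.eq_zero_or_pos k with rfl | hk0
    · rw [esymm_zero]; exact one_mem _
    have h := mul_esymm_eq_sum (Fin n) K k
    have hk' : (k : K) ≠ 0 := Nat.cast_ne_zero.2 hk0.ne'
    have h2 : esymm (Fin n) K k = (k : K)⁻¹ • ((k : MvPolynomial (Fin n) K) * esymm (Fin n) K k) := by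
      rw [smul_eq_C_mul, ← mul_assoc, ← map_natCast (C : K →+* MvPolynomial (Fin n) K), ← C_mul,
        inv_mul_cancel₀ hk', C_1, one_mul]
    rw [h2, h]
    refine Subalgebra.smul_mem _ (mul_mem (pow_mem (neg_mem (one_mem _)) _) (sum_mem ?_)) _
    intro a ha
    rw [mem_filter, HasAntidiagonal.mem_antidiagonal] at ha
    refine mul_mem (mul_mem (pow_mem (neg_mem (one_mem _)) _) (ih _ ha.2 (by omega))) ?_
    refine ⟨X ⟨a.2 - 1, by omega⟩, ?_⟩
    simp only [AlgHom.toRingHom_eq_coe, RingHom.coe_coe, AlgHom.comp_apply, Subalgebra.coe_val]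
    rw [coe_psumHom, aeval_X]
    congr 1
    show a.2 - 1 + 1 = a.2
    omega

theorem psumHom_surjective [CharZero K] : Function.Surjective (psumHom K n) := by
  intro f
  obtain ⟨g, rfl⟩ := (esymmAlgEquiv (Fin n) K (Fintype.card_fin n)).surjective f
  induction g using MvPolynomial.induction_on with
  | C a => exact ⟨C a, by rw [← algebraMap_eq, AlgEquiv.commutes, AlgHom.commutes]⟩
  | add p q hp hq =>
    obtain ⟨p', hp⟩ := hp
    obtain ⟨q', hq⟩ := hq
    exact ⟨p' + q', by rw [map_add, map_add, hp, hq]⟩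
  | mul_X p i hp =>
    obtain ⟨p', hp⟩ := hp
    obtain ⟨g, hg⟩ := esymm_mem_range_psumHom (K := K) (n := n) (i + 1) i.2
    have hX : psumHom K n g = esymmAlgEquiv (Fin n) K (Fintype.card_fin n) (X i) := by
      rw [← esymmAlgEquiv_symm_apply K (Fintype.card_fin n), AlgEquiv.apply_symm_apply]
      exact Subtype.ext hg
    exact ⟨p' * g, by rw [map_mul, map_mul, hp, hX]⟩

/-- Algebraic independence of p_1, …, p_n follows from generation: since Λ_n is a polynomial ring in
e_1, …, e_n, the map becomes a surjective endomorphism of a noetherian ring. -/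
theorem psumHom_injective [CharZero K] : Function.Injective (psumHom K n) := by
  let e := esymmAlgEquiv (Fin n) K (Fintype.card_fin n)
  have h := injective_of_surjective_ringEnd
    ((e.symm : SymPoly K n →ₐ[K] MvPolynomial (Fin n) K).comp (psumHom K n)).toRingHom
    (e.symm.surjective.comp psumHom_surjective)
  exact Function.Injective.of_comp (f := e.symm) h

/-- The multiplicities of the parts `1, …, n`. -/
noncomputable def mult (n : ℕ) (lam : Ptn) : Fin n →₀ ℕ :=
  Finsupp.equivFunOnFinite.symm fun i => lam.2.parts.count (i.1 + 1)

/-- The partition with given multiplicities of the parts `1, …, n`. -/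
def ofMult {n : ℕ} (α : Fin n →₀ ℕ) : Ptn :=
  ⟨(∑ i, Multiset.replicate (α i) (i.1 + 1)).sum,
    { parts := ∑ i, Multiset.replicate (α i) (i.1 + 1)
      parts_pos := fun {k} hk => by
        obtain ⟨i, _, hi⟩ := Multiset.mem_sum.1 hk
        rw [Multiset.eq_of_mem_replicate hi]
        exact Nat.succ_pos _
      parts_sum := rfl }⟩

theorem psumHom_monomial (lam : Ptn) (h : ∀ k ∈ lam.2.parts, k ≤ n) :
    psumHom K n (monomial (mult n lam) 1) = toVars K n (powerSumPart K lam) := by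
  refine Subtype.ext ?_
  rw [coe_psumHom, coe_toVars_powerSumPart, aeval_monomial, map_one, one_mul,
    Finsupp.prod_fintype _ _ (by simp), Finset.prod_multiset_map_count]
  let e : Fin n ↪ ℕ := ⟨fun i => i.1 + 1, fun i j hij => Fin.ext (Nat.succ_injective hij)⟩
  rw [prod_subset (s₂ := univ.map e)]
  · rw [prod_map]; rfl
  · intro k hk
    rw [Multiset.mem_toFinset] at hk
    have h0 := lam.2.parts_pos hk
    have h1 := h k hk
    exact mem_map.2 ⟨⟨k - 1, by omega⟩, mem_univ _, show k - 1 + 1 = k by omega⟩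
  · intro k _ hk
    rw [Multiset.mem_toFinset] at hk
    rw [Multiset.count_eq_zero_of_notMem hk, pow_zero]

theorem ofMult_parts_le (α : Fin n →₀ ℕ) : ∀ k ∈ (ofMult α).2.parts, k ≤ n := by
  intro k hk
  change k ∈ ∑ i, Multiset.replicate (α i) (i.1 + 1) at hk
  obtain ⟨i, _, hi⟩ := Multiset.mem_sum.1 hk
  rw [Multiset.eq_of_mem_replicate hi]
  exact i.2

theorem mult_ofMult (α : Fin n →₀ ℕ) : mult n (ofMult α) = α := by
  ext i
  simp only [mult, ofMult, Finsupp.equivFunOnFinite_symm_apply_apply]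
  rw [Multiset.count_sum']
  simp only [Multiset.count_replicate, Nat.add_right_cancel_iff, Fin.val_inj]
  simp

theorem Ptn.ext {lam μ : Ptn} (h : lam.2.parts = μ.2.parts) : lam = μ := by
  obtain ⟨d, lam⟩ := lam
  obtain ⟨e, μ⟩ := μ
  obtain rfl : d = e := by rw [← lam.parts_sum, ← μ.parts_sum]; exact congrArg _ h
  exact congrArg _ (Nat.Partition.ext h)

theorem mult_injOn : Set.InjOn (mult n) {lam : Ptn | ∀ k ∈ lam.2.parts, k ≤ n} := by
  intro lam hlam μ hμ h
  refine Ptn.ext (Multiset.ext.2 fun k => ?_)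
  by_cases hk : 0 < k ∧ k ≤ n
  · have := DFunLike.congr_fun h ⟨k - 1, by omega⟩
    simp only [mult, Finsupp.equivFunOnFinite_symm_apply_apply] at this
    rwa [show k - 1 + 1 = k by omega] at this
  · have h1 (ν : Ptn) (hν : ∀ k ∈ ν.2.parts, k ≤ n) : ν.2.parts.count k = 0 :=
      Multiset.count_eq_zero_of_notMem fun h => hk ⟨ν.2.parts_pos h, hν k h⟩
    rw [h1 _ hlam, h1 _ hμ]

/-- Partitions with parts at most n are determined by the multiplicities of 1, …, n, so their p_λ
are images of distinct monomials under the injective `psumHom`. -/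
theorem linearIndepOn_powerSumPart [CharZero K] (n : ℕ) :
    LinearIndepOn K (fun lam => toVars K n (powerSumPart K lam))
      {lam : Ptn | ∀ k ∈ lam.2.parts, k ≤ n} := by
  have h := (basisMonomials (Fin n) K).linearIndependent.comp
    (fun lam : {lam : Ptn | ∀ k ∈ lam.2.parts, k ≤ n} => mult n lam.1)
    (fun lam μ h => Subtype.ext (mult_injOn lam.2 μ.2 h))
  have h2 := h.map' (psumHom K n).toLinearMap
    (LinearMap.ker_eq_bot.2 psumHom_injective)
  have h3 : (fun lam : {lam : Ptn | ∀ k ∈ lam.2.parts, k ≤ n} =>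
      toVars K n (powerSumPart K lam.1)) = (psumHom K n).toLinearMap ∘
        (basisMonomials (Fin n) K) ∘ fun lam => mult n lam.1 := by
    ext lam : 1
    simp [psumHom_monomial lam.1 lam.2]
  show LinearIndependent K (fun lam : {lam : Ptn | ∀ k ∈ lam.2.parts, k ≤ n} =>
      toVars K n (powerSumPart K lam.1))
  rw [h3]
  exact h2

theorem part_le_size (lam : Ptn) : ∀ k ∈ lam.2.parts, k ≤ lam.1 := fun k hk => by
  rw [← lam.2.parts_sum]; exact Multiset.single_le_sum (by simp) k hk

theorem linearIndependent_powerSumPart [CharZero K] :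
    LinearIndependent K (powerSumPart K) := by
  refine linearIndependent_iff'ₛ.2 fun s f g hfg lam hlam => ?_
  -- A finite relation is tested in as many variables as the largest partition size involved, so
  -- that all parts are admissible.
  have h := linearIndepOn_powerSumPart (K := K) (s.sup Sigma.fst)
  rw [linearIndepOn_iff'] at h
  refine sub_eq_zero.1 (h s (fun i => f i - g i) (fun μ hμ k hk => ?_) ?_ lam hlam)
  · exact (part_le_size μ k hk).trans (le_sup (f := Sigma.fst) hμ)
  · have := congrArg (toVars K (s.sup Sigma.fst)) hfg
    simp only [map_sum, map_smul] at this
    simp only [sub_smul, sum_sub_distrib, this, sub_self]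

/-! ### Degree filtration on Λ and spanning by power sums -/

theorem isHomogeneous_psum (k : ℕ) : (psum (Fin n) K k).IsHomogeneous k :=
  IsHomogeneous.sum _ _ _ fun i _ => isHomogeneous_X_pow i k

theorem isHomogeneous_powerSumPart (n : ℕ) (lam : Ptn) :
    (toVars K n (powerSumPart K lam) : MvPolynomial (Fin n) K).IsHomogeneous lam.1 := by
  rw [coe_toVars_powerSumPart]
  conv => arg 2; rw [← lam.2.parts_sum]
  induction lam.2.parts using Multiset.induction_on with
  | empty => simpa using isHomogeneous_one (Fin n) K
  | cons k s ih => simpa using (isHomogeneous_psum k).mul ih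

/-- `f` is a symmetric function of degree at most `d`. -/
def DegLE (d : ℕ) (f : SymFun K) : Prop :=
  ∀ n, (toVars K n f : MvPolynomial (Fin n) K).totalDegree ≤ d

theorem exists_degLE (f : SymFun K) : ∃ d, DegLE d f := f.2.2

theorem degLE_powerSumPart (lam : Ptn) : DegLE lam.1 (powerSumPart K lam) :=
  fun n => (isHomogeneous_powerSumPart n lam).totalDegree_le

theorem toVars_sub (n : ℕ) (f g : SymFun K) : toVars K n (f - g) = toVars K n f - toVars K n g := rfl

theorem DegLE.sub {d : ℕ} {f g : SymFun K} (hf : DegLE d f) (hg : DegLE d g) : DegLE d (f - g) := by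
  intro n
  rw [toVars_sub]
  exact (totalDegree_sub _ _).trans (max_le (hf n) (hg n))

theorem DegLE.add {d : ℕ} {f g : SymFun K} (hf : DegLE d f) (hg : DegLE d g) : DegLE d (f + g) := by
  intro n
  rw [map_add]
  exact (totalDegree_add _ _).trans (max_le (hf n) (hg n))

theorem DegLE.smul {d : ℕ} (c : K) {f : SymFun K} (hf : DegLE d f) : DegLE d (c • f) := by
  intro n
  rw [map_smul]
  exact (totalDegree_smul_le _ _).trans (hf n)

theorem DegLE.mono {d e : ℕ} (h : d ≤ e) {f : SymFun K} (hf : DegLE d f) : DegLE e f :=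
  fun n => (hf n).trans h

theorem res_toVars (n : ℕ) (f : SymFun K) : res K n (toVars K (n + 1) f) = toVars K n f := f.2.1 n

theorem X_last_dvd_sub (f : MvPolynomial (Fin (n + 1)) K) :
    X (Fin.last n) ∣ f - rename Fin.castSucc (killLast K n f) := by
  induction f using MvPolynomial.induction_on with
  | C a => simp [killLast]
  | add p q hp hq =>
    rw [map_add, map_add, add_sub_add_comm]
    exact dvd_add hp hq
  | mul_X p k hp =>
    have h : p * X k - rename Fin.castSucc (killLast K n (p * X k)) =
        (p - rename Fin.castSucc (killLast K n p)) * X k +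
          rename Fin.castSucc (killLast K n p) * (X k - rename Fin.castSucc (killLast K n (X k))) := by
      rw [map_mul, map_mul]; ring
    rw [h]
    refine dvd_add (hp.mul_right _) (Dvd.dvd.mul_left ?_ _)
    refine Fin.lastCases ?_ (fun k => ?_) k <;> simp [killLast]

/-- Such an f is divisible by the last variable, by symmetry by every variable, hence by their
product, whose degree n + 1 is too large. -/
theorem eq_zero_of_killLast_eq_zero {f : MvPolynomial (Fin (n + 1)) K} (hf : f.IsSymmetric)
    (h0 : killLast K n f = 0) (hd : f.totalDegree ≤ n) : f = 0 := by
  have hlast : X (Fin.last n) ∣ f := by simpa [h0] using X_last_dvd_sub f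
  have hall (i : Fin (n + 1)) : X i ∣ f := by
    have := map_dvd (rename (Equiv.swap (Fin.last n) i) : _ →ₐ[K] _) hlast
    rwa [hf, rename_X, Equiv.swap_apply_left] at this
  have hprod : (∏ i, X i : MvPolynomial (Fin (n + 1)) K) ∣ f := by
    refine Finset.prod_dvd_of_isRelPrime ?_ fun i _ => hall i
    intro i _ j _ hij
    show IsRelPrime (X i : MvPolynomial (Fin (n + 1)) K) (X j)
    rw [(MvPolynomial.X_prime (R := K) (i := i)).irreducible.isRelPrime_iff_not_dvd, X_dvd_X]
    simpa using hij
  obtain ⟨g, rfl⟩ := hprod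
  by_contra hne
  have hg := right_ne_zero_of_mul hne
  rw [totalDegree_mul_of_isDomain (left_ne_zero_of_mul hne) hg] at hd
  have hh : (∏ i, X i : MvPolynomial (Fin (n + 1)) K).IsHomogeneous (∑ i : Fin (n + 1), 1) :=
    IsHomogeneous.prod _ _ _ fun i _ => isHomogeneous_X K i
  rw [hh.totalDegree (left_ne_zero_of_mul hne)] at hd
  simp at hd
  omega

theorem eq_zero_of_toVars_eq_zero {d N : ℕ} (hN : d ≤ N) {f : SymFun K} (hf : DegLE d f)
    (h0 : toVars K N f = 0) : f = 0 := by
  have hup : ∀ n, N ≤ n → toVars K n f = 0 := by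
    intro n hn
    induction n, hn using Nat.le_induction with
    | base => exact h0
    | succ n hn ih =>
      refine Subtype.ext (eq_zero_of_killLast_eq_zero (toVars K (n + 1) f).2 ?_
        ((hf _).trans (hN.trans hn)))
      rw [← coe_res, res_toVars, ih]
      rfl
  have hdown : ∀ k, toVars K (N - k) f = 0 := by
    intro k
    induction k with
    | zero => exact h0
    | succ k ih =>
      rcases Nat.lt_or_ge k N with hk | hk
      · obtain ⟨m, hm⟩ : ∃ m, N - k = m + 1 := ⟨N - k - 1, by omega⟩
        rw [hm] at ih
        rw [show N - (k + 1) = m by omega, ← res_toVars, ih, map_zero]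
      · rwa [show N - (k + 1) = N - k by omega]
  refine SymFun.ext fun n => ?_
  rw [map_zero]
  rcases le_total N n with h | h
  · exact hup n h
  · have := hdown (N - n)
    rwa [show N - (N - n) = n by omega] at this

theorem coe_mem_span_powerSumPart [CharZero K] (f : SymPoly K n) :
    (f : MvPolynomial (Fin n) K) ∈ Submodule.span K (Set.range fun lam : Ptn =>
      (toVars K n (powerSumPart K lam) : MvPolynomial (Fin n) K)) := by
  obtain ⟨g, rfl⟩ := psumHom_surjective f
  induction g using MvPolynomial.induction_on' with
  | monomial α a =>
    rw [← mul_one a, ← smul_eq_mul, ← smul_monomial, map_smul]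
    refine Submodule.smul_mem _ _ (Submodule.subset_span ⟨ofMult α, ?_⟩)
    simp only
    rw [← psumHom_monomial _ (ofMult_parts_le α), mult_ofMult]
  | add p q hp hq => rw [map_add]; exact Submodule.add_mem _ hp hq

theorem span_powerSumPart [CharZero K] : Submodule.span K (Set.range (powerSumPart K)) = ⊤ := by
  rw [eq_top_iff]
  rintro f -
  obtain ⟨d, hd⟩ := exists_degLE f
  -- An expansion of the image in d variables might involve p_λ with |λ| > d. Passing to homogeneous
  -- components of degree i ≤ d discards these, so the lift has degree at most d and is determined
  -- by d variables.
  have key : ∀ i ≤ d, ∃ g ∈ Submodule.span K (Set.range (powerSumPart K)), DegLE d g ∧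
      homogeneousComponent i (toVars K d f : MvPolynomial (Fin d) K) = toVars K d g := by
    intro i hi
    have h := coe_mem_span_powerSumPart (toVars K d f)
    generalize (toVars K d f : MvPolynomial (Fin d) K) = F at h
    induction h using Submodule.span_induction with
    | mem x hx =>
      obtain ⟨lam, rfl⟩ := hx
      simp only
      rw [homogeneousComponent_of_mem (isHomogeneous_powerSumPart d lam)]
      split_ifs with h
      · exact ⟨_, Submodule.subset_span ⟨lam, rfl⟩, (degLE_powerSumPart lam).mono (h ▸ hi), rfl⟩
      · exact ⟨0, Submodule.zero_mem _, fun n => by simp, by simp⟩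
    | zero => exact ⟨0, Submodule.zero_mem _, fun n => by simp, by simp⟩
    | add x y _ _ hx hy =>
      obtain ⟨g, hg, hgd, hx⟩ := hx
      obtain ⟨g', hg', hgd', hy⟩ := hy
      exact ⟨g + g', Submodule.add_mem _ hg hg', hgd.add hgd', by rw [map_add, hx, hy, map_add]; rfl⟩
    | smul a x _ hx =>
      obtain ⟨g, hg, hgd, hx⟩ := hx
      exact ⟨a • g, Submodule.smul_mem _ _ hg, hgd.smul a, by rw [map_smul, hx, map_smul]; rfl⟩
  choose! g hg hgd hgf using key
  have hsum : f = ∑ i ∈ range (d + 1), g i := by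
    rw [← sub_eq_zero]
    have hs : DegLE d (∑ i ∈ range (d + 1), g i) := by
      intro n
      rw [map_sum, AddSubmonoidClass.coe_finsetSum]
      exact totalDegree_finsetSum_le fun i hi => hgd i (Nat.lt_succ_iff.1 (mem_range.1 hi)) n
    refine eq_zero_of_toVars_eq_zero le_rfl (hd.sub hs) ?_
    rw [toVars_sub, sub_eq_zero, map_sum]
    refine Subtype.ext ?_
    rw [AddSubmonoidClass.coe_finsetSum]
    conv_lhs => rw [← sum_homogeneousComponent (toVars K d f : MvPolynomial (Fin d) K)]
    rw [sum_subset (s₂ := range (d + 1))]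
    · exact sum_congr rfl fun i hi => hgf i (Nat.lt_succ_iff.1 (mem_range.1 hi))
    · exact range_subset_range.2 (Nat.succ_le_succ (hd d))
    · intro i _ hi
      exact homogeneousComponent_eq_zero _ _ (by simpa using hi)
  rw [hsum]
  exact Submodule.sum_mem _ fun i hi => hg i (Nat.lt_succ_iff.1 (mem_range.1 hi))

/-- The basis `(p_λ)` of `Λ`. -/
noncomputable def powerSumBasis (K : Type*) [Field K] [CharZero K] : Module.Basis Ptn K (SymFun K) :=
  Module.Basis.mk linearIndependent_powerSumPart span_powerSumPart.ge

theorem powerSumBasis_apply [CharZero K] (lam : Ptn) : powerSumBasis K lam = powerSumPart K lam := by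
  simp [powerSumBasis]

/-- `Function.invFun` is meaningful here only because the p_λ form a basis; from now on coordinates
are linear. -/
theorem powerSumCoords_eq [CharZero K] (f : SymFun K) : powerSumCoords f = (powerSumBasis K).repr f := by
  have hs : Function.Surjective (Finsupp.linearCombination K (powerSumPart K)) := by
    rw [← LinearMap.range_eq_top, Finsupp.range_linearCombination, span_powerSumPart]
  have h := Function.invFun_eq (hs f)
  apply (powerSumBasis K).repr.symm.injective
  rw [LinearEquiv.symm_apply_apply, Module.Basis.repr_symm_apply]
  have hb : ⇑(powerSumBasis K) = powerSumPart K := funext powerSumBasis_apply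
  rw [hb]
  exact h

/-! ### The scalar product as a nondegenerate symmetric form -/

theorem normP_ne_zero [CharZero K] {q t : K} (hq : ∀ k : ℕ, 0 < k → q ^ k ≠ 1)
    (ht : ∀ k : ℕ, 0 < k → t ^ k ≠ 1) (lam : Ptn) : normP q t lam ≠ 0 := by
  refine mul_ne_zero (Nat.cast_ne_zero.2 (prod_ne_zero_iff.2 fun i hi => ?_)) ?_
  · have := lam.2.parts_pos (Multiset.mem_toFinset.1 hi)
    positivity
  · rw [Ne, Multiset.prod_eq_zero_iff, Multiset.mem_map]
    rintro ⟨k, hk, h⟩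
    have hk := lam.2.parts_pos hk
    exact div_ne_zero (sub_ne_zero.2 (hq k hk).symm) (sub_ne_zero.2 (ht k hk).symm) h

/-- The scalar product as a bilinear map. -/
noncomputable def scalarForm [CharZero K] (q t : K) : SymFun K →ₗ[K] SymFun K →ₗ[K] K :=
  LinearMap.mk₂ K (scalarProduct q t)
    (fun f f' g => by
      simp only [scalarProduct, powerSumCoords_eq, map_add]
      exact Finsupp.sum_add_index' (by simp) (by intros; ring))
    (fun c f g => by
      simp only [scalarProduct, powerSumCoords_eq, map_smul]
      rw [Finsupp.sum_smul_index (by simp), Finsupp.smul_sum]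
      simp [mul_assoc])
    (fun f g g' => by
      simp only [scalarProduct, powerSumCoords_eq, map_add, Finsupp.add_apply]
      rw [← Finsupp.sum_add]
      congr; ext; ring)
    (fun c f g => by
      simp only [scalarProduct, powerSumCoords_eq, map_smul, Finsupp.smul_apply]
      rw [Finsupp.smul_sum]
      congr; ext; simp only [smul_eq_mul]; ring)

theorem scalarForm_apply [CharZero K] (q t : K) (f g : SymFun K) :
    scalarForm q t f g = scalarProduct q t f g := rfl

theorem scalarForm_powerSum_left [CharZero K] (q t : K) (lam : Ptn) (g : SymFun K) :
    scalarForm q t (powerSumPart K lam) g = (powerSumBasis K).repr g lam * normP q t lam := by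
  rw [scalarForm_apply, scalarProduct, powerSumCoords_eq, powerSumCoords_eq, ← powerSumBasis_apply,
    Module.Basis.repr_self, Finsupp.sum_single_index (by simp), one_mul]

theorem scalarForm_comm [CharZero K] (q t : K) (f g : SymFun K) :
    scalarForm q t f g = scalarForm q t g f := by
  suffices h : scalarForm q t = (scalarForm q t).flip by
    exact congrArg (fun B => B f g) h
  refine (powerSumBasis K).ext fun lam => (powerSumBasis K).ext fun μ => ?_
  rw [LinearMap.flip_apply, powerSumBasis_apply, powerSumBasis_apply, scalarForm_powerSum_left,
    scalarForm_powerSum_left, ← powerSumBasis_apply, ← powerSumBasis_apply, Module.Basis.repr_self,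
    Module.Basis.repr_self]
  by_cases h : lam = μ
  · rw [h]
  · rw [Finsupp.single_eq_of_ne h, Finsupp.single_eq_of_ne (Ne.symm h), zero_mul, zero_mul]

/-- Pairing with p_λ reads off the p_λ-coordinate up to the nonzero norm. -/
theorem eq_zero_of_scalarForm_eq_zero [CharZero K] {q t : K} (hq : ∀ k : ℕ, 0 < k → q ^ k ≠ 1)
    (ht : ∀ k : ℕ, 0 < k → t ^ k ≠ 1) {f : SymFun K} (hf : ∀ g, scalarForm q t f g = 0) : f = 0 := by
  refine (LinearEquiv.map_eq_zero_iff (powerSumBasis K).repr).1 (Finsupp.ext fun lam => ?_)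
  have h := hf (powerSumPart K lam)
  rw [scalarForm_comm, scalarForm_powerSum_left] at h
  exact (mul_eq_zero.1 h).resolve_right (normP_ne_zero hq ht lam)

end Macdonald

namespace Macdonald
open Finset

/-! ### A Cauchy determinant identity -/

section Cauchy

variable {F : Type*} [Field F] {n : ℕ}

/-- The determinant of the coefficients of the polynomials `∏_{l ≠ j} (1 - y_l X)`. -/
noncomputable def cauchyCoeff (y : Fin n → F) : F :=
  (Matrix.of fun k j : Fin n =>
    (∏ l ∈ univ.erase j, (1 - Polynomial.C (y l) * Polynomial.X)).coeff k).det

/-- Column j holds the values at the x_i of a polynomial of degree less than n with coefficients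
depending only on y, so the matrix is a Vandermonde matrix times a coefficient matrix. The
determinant of the latter never has to be evaluated. -/
theorem det_prod_erase (x y : Fin n → F) :
    (Matrix.of fun i j : Fin n => ∏ l ∈ univ.erase j, (1 - x i * y l)).det =
      (Matrix.vandermonde x).det * cauchyCoeff y := by
  rw [cauchyCoeff, ← Matrix.det_mul]
  congr 1
  ext i j
  rw [Matrix.mul_apply, Matrix.of_apply]
  simp only [Matrix.vandermonde_apply, Matrix.of_apply]
  set g : Polynomial F := ∏ l ∈ univ.erase j, (1 - Polynomial.C (y l) * Polynomial.X) with hg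
  have hdeg : g.natDegree < n := by
    have h1 : g.natDegree ≤ ∑ l ∈ univ.erase j, 1 := by
      refine (Polynomial.natDegree_prod_le _ _).trans (sum_le_sum fun l _ => ?_)
      refine (Polynomial.natDegree_sub_le _ _).trans (max_le (by simp) ?_)
      exact (Polynomial.natDegree_C_mul_le _ _).trans Polynomial.natDegree_X_le
    rw [sum_const, card_erase_of_mem (mem_univ _), card_univ, Fintype.card_fin, smul_eq_mul,
      mul_one] at h1
    have := j.2
    omega
  have heval : ∏ l ∈ univ.erase j, (1 - x i * y l) = g.eval (x i) := by
    rw [hg, Polynomial.eval_prod]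
    refine prod_congr rfl fun l _ => ?_
    rw [Polynomial.eval_sub, Polynomial.eval_one, Polynomial.eval_C_mul, Polynomial.eval_X, mul_comm]
  rw [heval, Polynomial.eval_eq_sum_range' hdeg, ← Fin.sum_univ_eq_sum_range
    (fun k => g.coeff k * x i ^ k)]
  exact sum_congr rfl fun k _ => mul_comm _ _

theorem prod_mul_det_inv (x y : Fin n → F) (h : ∀ i j, 1 - x i * y j ≠ 0) :
    (∏ i, ∏ j, (1 - x i * y j)) * (Matrix.of fun i j => (1 - x i * y j)⁻¹).det =
      (Matrix.vandermonde x).det * cauchyCoeff y := by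
  rw [← det_prod_erase, ← Matrix.det_mul_column]
  congr 1
  ext i j
  simp only [Matrix.of_apply]
  rw [← mul_prod_erase univ _ (mem_univ j), mul_comm, inv_mul_cancel_left₀ (h i j)]

theorem prod_mul_det_inv_comm (x y : Fin n → F) (h : ∀ i j, 1 - x i * y j ≠ 0) :
    (∏ i, ∏ j, (1 - x i * y j)) * (Matrix.of fun i j => (1 - x i * y j)⁻¹).det =
      (Matrix.vandermonde y).det * cauchyCoeff x := by
  rw [← prod_mul_det_inv y x fun i j => by rw [mul_comm]; exact h j i, prod_comm,
    ← Matrix.det_transpose]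
  congr 1
  · exact prod_congr rfl fun i _ => prod_congr rfl fun j _ => by rw [mul_comm]
  · congr 1
    ext i j
    simp [mul_comm]

/-- Take x_i = 1/y_i: the matrix of products becomes diagonal with nonzero entries ∏_{l ≠ j} (1 -
y_l/y_j). -/
theorem cauchyCoeff_ne_zero (y : Fin n → F) (hy : Function.Injective y) (hy0 : ∀ i, y i ≠ 0) :
    cauchyCoeff y ≠ 0 := by
  have h := det_prod_erase (fun i => (y i)⁻¹) y
  have hdiag : (Matrix.of fun i j : Fin n => ∏ l ∈ univ.erase j, (1 - (y i)⁻¹ * y l)) =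
      Matrix.diagonal fun j => ∏ l ∈ univ.erase j, (1 - (y j)⁻¹ * y l) := by
    ext i j
    by_cases hij : i = j
    · subst hij; simp
    · rw [Matrix.diagonal_apply_ne _ hij, Matrix.of_apply]
      exact prod_eq_zero (mem_erase.2 ⟨hij, mem_univ _⟩) (by rw [inv_mul_cancel₀ (hy0 i), sub_self])
  rw [hdiag, Matrix.det_diagonal] at h
  intro h0
  rw [h0, mul_zero, prod_eq_zero_iff] at h
  obtain ⟨j, _, hj⟩ := h
  obtain ⟨l, hl, hjl⟩ := prod_eq_zero_iff.1 hj
  rw [sub_eq_zero, eq_comm, inv_mul_eq_one₀ (hy0 j)] at hjl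
  exact (mem_erase.1 hl).1 (hy hjl.symm)

/-- Multiply the entries with index in `I` by `t`. -/
def scale {R : Type*} [Mul R] (t : R) (I : Finset (Fin n)) (x : Fin n → R) (i : Fin n) : R :=
  if i ∈ I then t * x i else x i

/-- In the Leibniz term of σ, scaling the rows in I is the same as scaling the columns in σ⁻¹(I),
and |σ⁻¹(I)| = |I|. -/
theorem sum_det_scale (x y : Fin n → F) (t : F) (r : ℕ) :
    ∑ I ∈ powersetCard r univ, (Matrix.of fun i j => (1 - scale t I x i * y j)⁻¹).det =
      ∑ I ∈ powersetCard r univ, (Matrix.of fun i j => (1 - x i * scale t I y j)⁻¹).det := by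
  simp only [Matrix.det_apply]
  rw [sum_comm, sum_comm (s := powersetCard r univ)]
  refine sum_congr rfl fun σ _ => ?_
  refine sum_bij' (fun I _ => I.map σ.symm.toEmbedding) (fun I _ => I.map σ.toEmbedding)
    ?_ ?_ ?_ ?_ ?_
  · simp [mem_powersetCard]
  · simp [mem_powersetCard]
  · intro I _; ext a; simp [mem_map_equiv]
  · intro I _; ext a; simp [mem_map_equiv]
  · intro I _
    congr 1
    refine prod_congr rfl fun i _ => ?_
    have h : i ∈ I.map σ.symm.toEmbedding ↔ σ i ∈ I := by simp [mem_map_equiv]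
    simp only [Matrix.of_apply, scale, h]
    split_ifs
    · rw [mul_assoc, mul_left_comm]
    · rfl

/-- The weight with which `I` enters the kernel identity. -/
def kernelWeight {R : Type*} [CommRing R] (t : R) (x y : Fin n → R) (I : Finset (Fin n)) : R :=
  (∏ i ∈ I, ∏ j, (1 - x i * y j)) * ∏ i ∈ Iᶜ, ∏ j, (1 - t * (x i * y j))

/-- The weight over the common denominator ∏(1 - t x_i y_j) is the ratio of the Cauchy denominators
before and after scaling. -/
theorem kernelWeight_mul (t : F) (x y : Fin n → F) (I : Finset (Fin n)) :
    kernelWeight t x y I * ∏ i, ∏ j, (1 - scale t I x i * y j) =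
      (∏ i, ∏ j, (1 - x i * y j)) * ∏ i, ∏ j, (1 - t * (x i * y j)) := by
  rw [← prod_mul_prod_compl I (fun i => ∏ j, (1 - scale t I x i * y j)),
    ← prod_mul_prod_compl I (fun i => ∏ j, (1 - x i * y j)),
    ← prod_mul_prod_compl I (fun i => ∏ j, (1 - t * (x i * y j)))]
  have h1 : ∏ i ∈ I, ∏ j, (1 - scale t I x i * y j) = ∏ i ∈ I, ∏ j, (1 - t * (x i * y j)) :=
    prod_congr rfl fun i hi => prod_congr rfl fun j _ => by rw [scale, if_pos hi, mul_assoc]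
  have h2 : ∏ i ∈ Iᶜ, ∏ j, (1 - scale t I x i * y j) = ∏ i ∈ Iᶜ, ∏ j, (1 - x i * y j) :=
    prod_congr rfl fun i hi => prod_congr rfl fun j _ => by rw [scale, if_neg (mem_compl.1 hi)]
  rw [h1, h2, kernelWeight]
  ring

theorem sum_vandermonde_kernelWeight_aux (t : F) (x y : Fin n → F) (r : ℕ)
    (h1 : ∀ i j, 1 - x i * y j ≠ 0) (h2 : ∀ i j, 1 - t * (x i * y j) ≠ 0) :
    cauchyCoeff y * ∑ I ∈ powersetCard r univ,
        (Matrix.vandermonde (scale t I x)).det * kernelWeight t x y I =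
      ((∏ i, ∏ j, (1 - x i * y j)) * ∏ i, ∏ j, (1 - t * (x i * y j))) *
        ∑ I ∈ powersetCard r univ, (Matrix.of fun i j => (1 - scale t I x i * y j)⁻¹).det := by
  rw [mul_sum, mul_sum]
  refine sum_congr rfl fun I _ => ?_
  rw [← kernelWeight_mul t x y I, mul_assoc, prod_mul_det_inv]
  · ring
  · intro i j
    rw [scale]
    split_ifs
    · rw [mul_assoc]; exact h2 i j
    · exact h1 i j

/-- The kernel identity behind the self-adjointness of the Macdonald operators. -/
theorem sum_vandermonde_kernelWeight (t : F) (x y : Fin n → F) (r : ℕ)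
    (hx : Function.Injective x) (hx0 : ∀ i, x i ≠ 0) (hy : Function.Injective y)
    (hy0 : ∀ i, y i ≠ 0) (h1 : ∀ i j, 1 - x i * y j ≠ 0) (h2 : ∀ i j, 1 - t * (x i * y j) ≠ 0) :
    (Matrix.vandermonde y).det * ∑ I ∈ powersetCard r univ,
        (Matrix.vandermonde (scale t I x)).det * kernelWeight t x y I =
      (Matrix.vandermonde x).det * ∑ I ∈ powersetCard r univ,
        (Matrix.vandermonde (scale t I y)).det * kernelWeight t y x I := by
  -- By `e1` and `e2` both sums, times their Cauchy coefficient, are the same sum of determinants;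
  -- `e5` compares the two evaluations of the unscaled Cauchy determinant.
  refine mul_left_cancel₀ (mul_ne_zero (cauchyCoeff_ne_zero x hx hx0)
    (cauchyCoeff_ne_zero y hy hy0)) ?_
  have e1 := sum_vandermonde_kernelWeight_aux t x y r h1 h2
  have e2 := sum_vandermonde_kernelWeight_aux t y x r (fun i j => by rw [mul_comm]; exact h1 j i)
    (fun i j => by rw [mul_comm (y i)]; exact h2 j i)
  have e3 : ∑ I ∈ powersetCard r univ, (Matrix.of fun i j => (1 - scale t I y i * x j)⁻¹).det =
      ∑ I ∈ powersetCard r univ, (Matrix.of fun i j => (1 - scale t I x i * y j)⁻¹).det := by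
    rw [sum_det_scale x y t r]
    refine sum_congr rfl fun I _ => ?_
    rw [← Matrix.det_transpose]
    congr 1
    ext i j
    simp [mul_comm]
  have e4 : (∏ i, ∏ j, (1 - y i * x j)) * ∏ i, ∏ j, (1 - t * (y i * x j)) =
      (∏ i, ∏ j, (1 - x i * y j)) * ∏ i, ∏ j, (1 - t * (x i * y j)) := by
    congr 1
    · rw [prod_comm]
      exact prod_congr rfl fun i _ => prod_congr rfl fun j _ => by rw [mul_comm]
    · rw [prod_comm]
      exact prod_congr rfl fun i _ => prod_congr rfl fun j _ => by rw [mul_comm (y j)]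
  have e5 := (prod_mul_det_inv x y h1).symm.trans (prod_mul_det_inv_comm x y h1)
  rw [e3, e4, ← e1] at e2
  linear_combination (-(Matrix.vandermonde x).det * cauchyCoeff y) * e2 -
    (cauchyCoeff y * ∑ I ∈ powersetCard r univ,
      (Matrix.vandermonde (scale t I x)).det * kernelWeight t x y I) * e5

end Cauchy

/-! ### Logarithmic derivatives of power series -/

section LogDeriv

/-- `S` is the logarithmic derivative `z d/dz log G` of the power series `G`. -/
def IsLogDeriv {A : Type*} [CommRing A] (G S : PowerSeries A) : Prop :=
  PowerSeries.X * PowerSeries.derivative A G = G * S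

variable {A : Type*} [CommRing A]

theorem isLogDeriv_iff {G S : PowerSeries A} :
    IsLogDeriv G S ↔ ∀ k : ℕ, (k : A) * PowerSeries.coeff k G = PowerSeries.coeff k (G * S) := by
  rw [IsLogDeriv, PowerSeries.ext_iff]
  refine forall_congr' fun k => ?_
  cases k with
  | zero => simp
  | succ k =>
    rw [PowerSeries.coeff_succ_X_mul, PowerSeries.coeff_derivative, mul_comm]
    push_cast
    rfl

theorem IsLogDeriv.mul {G H S T : PowerSeries A} (hG : IsLogDeriv G S) (hH : IsLogDeriv H T) :
    IsLogDeriv (G * H) (S + T) := by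
  unfold IsLogDeriv at *
  rw [Derivation.leibniz, smul_eq_mul, smul_eq_mul]
  linear_combination G * hH + H * hG

theorem isLogDeriv_one : IsLogDeriv (1 : PowerSeries A) 0 := by
  simp [IsLogDeriv]

theorem IsLogDeriv.prod {ι : Type*} (s : Finset ι) (G S : ι → PowerSeries A)
    (h : ∀ i ∈ s, IsLogDeriv (G i) (S i)) : IsLogDeriv (∏ i ∈ s, G i) (∑ i ∈ s, S i) := by
  classical
  induction s using Finset.induction_on with
  | empty => simpa using isLogDeriv_one
  | insert i s hi ih =>
    rw [prod_insert hi, sum_insert hi]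
    exact (h i (mem_insert_self _ _)).mul (ih fun j hj => h j (mem_insert_of_mem hj))

theorem IsLogDeriv.map {B : Type*} [CommRing B] (φ : A →+* B) {G S : PowerSeries A}
    (h : IsLogDeriv G S) : IsLogDeriv (PowerSeries.map φ G) (PowerSeries.map φ S) := by
  rw [isLogDeriv_iff] at h ⊢
  intro k
  rw [← map_mul, PowerSeries.coeff_map, PowerSeries.coeff_map, ← h k, map_mul, map_natCast]

/-- As S has no constant term, k g_k is determined by the earlier coefficients; characteristic 0
allows division by k. -/
theorem IsLogDeriv.unique [IsDomain A] [CharZero A] {G H S : PowerSeries A} (hG : IsLogDeriv G S)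
    (hH : IsLogDeriv H S) (hS : PowerSeries.coeff 0 S = 0)
    (h0 : PowerSeries.coeff 0 G = PowerSeries.coeff 0 H) : G = H := by
  rw [isLogDeriv_iff] at hG hH
  ext k
  induction k using Nat.strong_induction_on with
  | _ k ih =>
    rcases Nat.eq_zero_or_pos k with rfl | hk
    · exact h0
    refine mul_left_cancel₀ (Nat.cast_ne_zero.2 hk.ne' : (k : A) ≠ 0) ?_
    rw [hG, hH, PowerSeries.coeff_mul, PowerSeries.coeff_mul]
    refine sum_congr rfl fun p hp => ?_
    rw [HasAntidiagonal.mem_antidiagonal] at hp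
    rcases Nat.eq_zero_or_pos p.2 with h2 | h2
    · rw [h2, hS, mul_zero, mul_zero]
    · rw [ih p.1 (by omega)]

theorem isLogDeriv_one_sub (a : A) :
    IsLogDeriv (1 - PowerSeries.C a * PowerSeries.X)
      (PowerSeries.mk fun k => if k = 0 then 0 else -a ^ k) := by
  rw [isLogDeriv_iff]
  intro k
  rw [sub_mul, one_mul, map_sub, map_sub, mul_assoc, PowerSeries.coeff_C_mul,
    PowerSeries.coeff_C_mul, PowerSeries.coeff_mk]
  rcases k with _ | k
  · simp
  · rw [PowerSeries.coeff_succ_X_mul, PowerSeries.coeff_mk, PowerSeries.coeff_X,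
      PowerSeries.coeff_one]
    rcases k with _ | k
    · simp
    · simp [pow_succ']

end LogDeriv

/-! ### The kernel in terms of power sums -/

section PartitionSum

/-- `∏_i i^{m_i} m_i!` for a multiset with multiplicities `m_i`. -/
def zMultiset (s : Multiset ℕ) : ℕ := ∏ i ∈ s.toFinset, i ^ s.count i * (s.count i).factorial

theorem zMultiset_eq_prod {s : Multiset ℕ} {T : Finset ℕ} (h : s.toFinset ⊆ T) :
    zMultiset s = ∏ i ∈ T, i ^ s.count i * (s.count i).factorial := by
  refine prod_subset h fun i _ hi => ?_
  rw [Multiset.count_eq_zero_of_notMem (by simpa using hi)]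
  simp

theorem zMultiset_cons (k : ℕ) (s : Multiset ℕ) :
    zMultiset (k ::ₘ s) = k * (s.count k + 1) * zMultiset s := by
  rw [zMultiset_eq_prod (T := insert k s.toFinset) (by simp),
    zMultiset_eq_prod (T := insert k s.toFinset) (subset_insert _ _),
    ← mul_prod_erase _ _ (mem_insert_self k s.toFinset),
    ← mul_prod_erase (a := k) _ _ (mem_insert_self k s.toFinset), Multiset.count_cons_self,
    Nat.factorial_succ, pow_succ]
  rw [prod_congr rfl (g := fun i => i ^ s.count i * (s.count i).factorial) fun i hi => by
    rw [Multiset.count_cons_of_ne (mem_erase.1 hi).1]]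
  ring

variable {K : Type*} [Field K] {A : Type*} [CommRing A] [Algebra K A]

/-- `∑_{|λ| = d} z_λ⁻¹ ∏_i w_{λ_i}`. -/
noncomputable def partitionSum (K : Type*) [Field K] {A : Type*} [CommRing A] [Algebra K A]
    (w : ℕ → A) (d : ℕ) : A :=
  ∑ lam : Nat.Partition d, (zMultiset lam.parts : K)⁻¹ • (lam.parts.map w).prod

/-- Write d = ∑ k m_k over the distinct parts k of λ. Removing one part k gives k m_k / z_λ = 1 /
z_{λ∖k}, and the pairs (λ, k) correspond to a k in 1, …, d together with a partition of d - k. -/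
theorem mul_partitionSum [CharZero K] (w : ℕ → A) (d : ℕ) :
    (d : A) * partitionSum K w d = ∑ k ∈ Icc 1 d, w k * partitionSum K w (d - k) := by
  have h1 : (d : A) * partitionSum K w d = ∑ lam : Nat.Partition d, ∑ k ∈ lam.parts.toFinset,
      w k * ((zMultiset (lam.parts.erase k) : K)⁻¹ • ((lam.parts.erase k).map w).prod) := by
    rw [partitionSum, mul_sum]
    refine sum_congr rfl fun lam _ => ?_
    have hd : (d : A) = ∑ k ∈ lam.parts.toFinset, ((lam.parts.count k * k : ℕ) : A) := by
      rw [← Nat.cast_sum]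
      congr 1
      conv_lhs => rw [← lam.parts_sum, Finset.sum_multiset_count]
      simp
    rw [hd, sum_mul]
    refine sum_congr rfl fun k hk => ?_
    rw [Multiset.mem_toFinset] at hk
    have hk0 := lam.parts_pos hk
    obtain ⟨s, hs⟩ := Multiset.exists_cons_of_mem hk
    rw [hs, Multiset.erase_cons_head, Multiset.map_cons, Multiset.prod_cons, zMultiset_cons,
      Multiset.count_cons_self]
    have hk0' : (k : K) ≠ 0 := Nat.cast_ne_zero.2 hk0.ne'
    have hc : ((s.count k + 1 : ℕ) : K) ≠ 0 := Nat.cast_ne_zero.2 (Nat.succ_ne_zero _)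
    rw [mul_smul_comm, ← nsmul_eq_mul, ← Nat.cast_smul_eq_nsmul K, smul_smul, mul_smul_comm]
    congr 1
    push_cast at hc ⊢
    rw [mul_inv, mul_comm (s.count k + 1 : K), mul_comm (_ * _)⁻¹, mul_assoc,
      inv_mul_cancel₀ (mul_ne_zero hk0' hc), mul_one]
  rw [h1, sum_sigma']
  simp only [partitionSum, mul_sum]
  rw [sum_sigma']
  refine sum_bij'
    (fun p hp => ⟨p.2, ⟨p.1.parts.erase p.2,
      fun h => p.1.parts_pos (Multiset.mem_of_mem_erase h), ?_⟩⟩)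
    (fun p hp => ⟨⟨p.1 ::ₘ p.2.parts, fun {i} h => ?_, ?_⟩, p.1⟩) ?_ ?_ ?_ ?_ ?_
  · rw [mem_sigma, Multiset.mem_toFinset] at hp
    have := Multiset.sum_erase hp.2
    rw [p.1.parts_sum] at this
    omega
  · rw [mem_sigma, mem_Icc] at hp
    rcases Multiset.mem_cons.1 h with rfl | h
    · omega
    · exact p.2.parts_pos h
  · rw [mem_sigma, mem_Icc] at hp
    rw [Multiset.sum_cons, p.2.parts_sum]
    omega
  · intro p hp
    rw [mem_sigma, Multiset.mem_toFinset] at hp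
    have h := part_le_size ⟨d, p.1⟩ p.2 hp.2
    have h' := p.1.parts_pos hp.2
    simp only [mem_sigma, mem_Icc, mem_univ, and_true]
    exact ⟨h', h⟩
  · intro p hp
    simp
  · intro p hp
    rw [mem_sigma, Multiset.mem_toFinset] at hp
    refine Sigma.ext (Nat.Partition.ext ?_) HEq.rfl
    exact Multiset.cons_erase hp.2
  · intro p hp
    refine Sigma.ext rfl (heq_of_eq (Nat.Partition.ext ?_))
    exact Multiset.erase_cons_head _ _
  · intro p hp
    rfl

/-- The series is formally exp(∑ w_k z^k / k); the logarithmic derivative replaces the exponential.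
-/
theorem isLogDeriv_partitionSum [CharZero K] (w : ℕ → A) :
    IsLogDeriv (PowerSeries.mk (partitionSum K w))
      (PowerSeries.mk fun k => if k = 0 then 0 else w k) := by
  rw [isLogDeriv_iff]
  intro d
  rw [PowerSeries.coeff_mk, mul_partitionSum, mul_comm, PowerSeries.coeff_mul,
    Finset.Nat.sum_antidiagonal_eq_sum_range_succ_mk]
  simp only [PowerSeries.coeff_mk]
  rw [sum_range_succ', if_pos rfl, zero_mul, add_zero, range_eq_Ico,
    sum_Ico_add' (fun k => (if k = 0 then 0 else w k) * partitionSum K w (d - k)) 0 d 1]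
  refine sum_congr (by ext; simp) fun k hk => ?_
  rw [if_neg (by have := (mem_Ico.1 hk).1; omega)]

theorem partitionSum_zero (w : ℕ → A) : partitionSum K w 0 = 1 := by
  rw [partitionSum, Fintype.sum_eq_single (Nat.Partition.indiscrete 0) (fun x hx =>
    (hx (Subsingleton.elim _ _)).elim)]
  simp [zMultiset]

/-- Adding ∑_l ((t a_l)^k - a_l^k) to w_k multiplies the series by ∏_l (1 - a_l z)/(1 - t a_l z).
Cleared of denominators, both sides have the same logarithmic derivative and constant term 1. -/
theorem map_partitionSum_mul_prod [CharZero K] [IsDomain A] (t : K) (w : ℕ → A) (τ : A →ₐ[K] A) {ι : Type*}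
    (s : Finset ι) (a : ι → A) (h : ∀ k, 0 < k → τ (w k) = w k + (t ^ k - 1) • ∑ l ∈ s, a l ^ k) :
    PowerSeries.map (τ : A →+* A) (PowerSeries.mk (partitionSum K w)) *
        ∏ l ∈ s, (1 - PowerSeries.C (t • a l) * PowerSeries.X) =
      PowerSeries.mk (partitionSum K w) * ∏ l ∈ s, (1 - PowerSeries.C (a l) * PowerSeries.X) := by
  have hA : CharZero A := charZero_of_injective_algebraMap (algebraMap K A).injective
  have hG := isLogDeriv_partitionSum (K := K) w
  have h1 := (hG.map (τ : A →+* A)).mul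
    (IsLogDeriv.prod s _ _ fun l _ => isLogDeriv_one_sub (t • a l))
  have h2 := hG.mul (IsLogDeriv.prod s _ _ fun l _ => isLogDeriv_one_sub (a l))
  have hS : PowerSeries.map (τ : A →+* A) (PowerSeries.mk fun k => if k = 0 then 0 else w k) +
      ∑ l ∈ s, PowerSeries.mk (fun k => if k = 0 then 0 else -(t • a l) ^ k) =
      PowerSeries.mk (fun k => if k = 0 then 0 else w k) +
      ∑ l ∈ s, PowerSeries.mk (fun k => if k = 0 then 0 else -a l ^ k) := by
    ext k
    simp only [map_add, map_sum, PowerSeries.coeff_map, PowerSeries.coeff_mk]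
    rcases Nat.eq_zero_or_pos k with rfl | hk
    · simp
    · simp only [if_neg hk.ne', RingHom.coe_coe, h k hk, smul_pow, sum_neg_distrib, ← smul_sum]
      rw [sub_smul, one_smul]
      ring
  rw [hS] at h1
  refine h1.unique h2 ?_ ?_
  · simp
  · have h0 : PowerSeries.constantCoeff (PowerSeries.map (τ : A →+* A)
        (PowerSeries.mk (partitionSum K w))) = 1 := by
      rw [← PowerSeries.coeff_zero_eq_constantCoeff_apply, PowerSeries.coeff_map,
        PowerSeries.coeff_mk, partitionSum_zero, map_one]
    simp [h0, partitionSum_zero, PowerSeries.coeff_zero_eq_constantCoeff, map_prod]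

end PartitionSum

end Macdonald

namespace Macdonald
open Finset

/-! ### Self-adjointness -/

theorem map_det_vandermonde {R S : Type*} [CommRing R] [CommRing S] {n : ℕ} (φ : R →+* S)
    (x : Fin n → R) :
    φ (Matrix.vandermonde x).det = (Matrix.vandermonde fun i => φ (x i)).det := by
  rw [RingHom.map_det]
  congr 1
  ext i j
  simp [Matrix.vandermonde_apply]

theorem det_vandermonde_mul {R : Type*} [CommRing R] {n : ℕ} (c : R) (x : Fin n → R) :
    (Matrix.vandermonde fun i => c * x i).det =
      c ^ (∑ i : Fin n, (Ioi i).card) * (Matrix.vandermonde x).det := by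
  rw [Matrix.det_vandermonde, Matrix.det_vandermonde]
  simp only [← mul_sub, prod_mul_distrib, prod_const, prod_pow_eq_pow_sum]

theorem sum_vandermonde_kernelWeight_of_isDomain {R : Type*} [CommRing R] [IsDomain R] {n : ℕ}
    (t : R) (x y : Fin n → R) (r : ℕ)
    (hx : Function.Injective x) (hx0 : ∀ i, x i ≠ 0) (hy : Function.Injective y)
    (hy0 : ∀ i, y i ≠ 0) (h1 : ∀ i j, 1 - x i * y j ≠ 0) (h2 : ∀ i j, 1 - t * (x i * y j) ≠ 0) :
    (Matrix.vandermonde y).det * ∑ I ∈ powersetCard r univ,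
        (Matrix.vandermonde (scale t I x)).det * kernelWeight t x y I =
      (Matrix.vandermonde x).det * ∑ I ∈ powersetCard r univ,
        (Matrix.vandermonde (scale t I y)).det * kernelWeight t y x I := by
  have hinj := IsFractionRing.injective R (FractionRing R)
  set φ := algebraMap R (FractionRing R)
  have hne {a : R} (ha : a ≠ 0) : φ a ≠ 0 := fun h => ha ((map_eq_zero_iff _ hinj).1 h)
  have h := sum_vandermonde_kernelWeight (φ t) (fun i => φ (x i)) (fun i => φ (y i)) r
    (hinj.comp hx) (fun i => hne (hx0 i)) (hinj.comp hy) (fun i => hne (hy0 i))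
    (fun i j => by simpa using hne (h1 i j)) (fun i j => by simpa using hne (h2 i j))
  have hs (I : Finset (Fin n)) (z : Fin n → R) :
      φ (Matrix.vandermonde (scale t I z)).det =
        (Matrix.vandermonde (scale (φ t) I fun i => φ (z i))).det := by
    rw [map_det_vandermonde]
    congr 2
    ext i
    simp only [scale]
    split_ifs <;> simp
  have hw (I : Finset (Fin n)) (z w : Fin n → R) : φ (kernelWeight t z w I) =
      kernelWeight (φ t) (fun i => φ (z i)) (fun i => φ (w i)) I := by
    simp [kernelWeight]
  apply hinj
  simp only [map_mul, map_sum, hs, hw, map_det_vandermonde]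
  exact h

variable {K : Type*} [Field K] {n : ℕ}

/-! ### The kernel in two sets of variables -/

/-- Polynomials in two sets of variables `x_1, …, x_n` and `y_1, …, y_n`. -/
abbrev BiPoly (K : Type*) [Field K] (n : ℕ) : Type _ := MvPolynomial (Fin n ⊕ Fin n) K

/-- `f ↦ f(x)`. -/
noncomputable def inX (K : Type*) [Field K] (n : ℕ) : MvPolynomial (Fin n) K →ₐ[K] BiPoly K n :=
  rename Sum.inl

/-- `f ↦ f(y)`. -/
noncomputable def inY (K : Type*) [Field K] (n : ℕ) : MvPolynomial (Fin n) K →ₐ[K] BiPoly K n :=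
  rename Sum.inr

theorem inX_injective : Function.Injective (inX K n) := rename_injective _ Sum.inl_injective

theorem inY_injective : Function.Injective (inY K n) := rename_injective _ Sum.inr_injective

/-- Multiply the variables `x_i`, `i ∈ I`, by `q`. -/
noncomputable def shiftX (q : K) (I : Finset (Fin n)) : BiPoly K n →ₐ[K] BiPoly K n :=
  aeval (Sum.elim (fun i => if i ∈ I then C q * X (Sum.inl i) else X (Sum.inl i))
    fun j => X (Sum.inr j))

/-- Multiply the variables `y_i`, `i ∈ I`, by `q`. -/
noncomputable def shiftY (q : K) (I : Finset (Fin n)) : BiPoly K n →ₐ[K] BiPoly K n :=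
  aeval (Sum.elim (fun i => X (Sum.inl i))
    fun j => if j ∈ I then C q * X (Sum.inr j) else X (Sum.inr j))

theorem shiftX_inX (q : K) (I : Finset (Fin n)) (f : MvPolynomial (Fin n) K) :
    shiftX q I (inX K n f) = inX K n (shift q I f) := by
  rw [← AlgHom.comp_apply, ← AlgHom.comp_apply]
  congr 1
  ext i : 1
  by_cases h : i ∈ I <;> simp [shiftX, inX, shift, h]

theorem shiftX_inY (q : K) (I : Finset (Fin n)) (f : MvPolynomial (Fin n) K) :
    shiftX q I (inY K n f) = inY K n f := by
  rw [← AlgHom.comp_apply]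
  congr 1
  ext i : 1
  simp [shiftX, inY]

theorem shiftY_inY (q : K) (I : Finset (Fin n)) (f : MvPolynomial (Fin n) K) :
    shiftY q I (inY K n f) = inY K n (shift q I f) := by
  rw [← AlgHom.comp_apply, ← AlgHom.comp_apply]
  congr 1
  ext i : 1
  by_cases h : i ∈ I <;> simp [shiftY, inY, shift, h]

theorem shiftY_inX (q : K) (I : Finset (Fin n)) (f : MvPolynomial (Fin n) K) :
    shiftY q I (inX K n f) = inX K n f := by
  rw [← AlgHom.comp_apply]
  congr 1
  ext i : 1
  simp [shiftY, inX]

/-- `(1 - t^k) / (1 - q^k) p_k(x) p_k(y)`. -/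
noncomputable def kernelPow (q t : K) (n k : ℕ) : BiPoly K n :=
  ((1 - q ^ k) / (1 - t ^ k))⁻¹ • (inX K n (psum (Fin n) K k) * inY K n (psum (Fin n) K k))

/-- The power sum `p_λ` in `n` variables. -/
noncomputable def psumVars (K : Type*) [Field K] (n : ℕ) {d : ℕ} (lam : Nat.Partition d) :
    SymPoly K n := toVars K n (powerSumPart K ⟨d, lam⟩)

theorem partitionSum_kernelPow (q t : K) (n d : ℕ) :
    partitionSum K (kernelPow q t n) d = ∑ lam : Nat.Partition d, (normP q t ⟨d, lam⟩)⁻¹ •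
      (inX K n (psumVars K n lam) * inY K n (psumVars K n lam)) := by
  refine sum_congr rfl fun lam _ => ?_
  rw [psumVars, coe_toVars_powerSumPart, map_multiset_prod, map_multiset_prod, Multiset.map_map,
    Multiset.map_map, ← Multiset.prod_map_mul, normP, mul_inv, mul_smul]
  congr 1
  simp only
  generalize lam.parts = s
  induction s using Multiset.induction_on with
  | empty => simp
  | cons k s ih =>
    simp only [Multiset.map_cons, Multiset.prod_cons, ih, kernelPow, mul_inv, Function.comp_apply]
    rw [smul_mul_smul_comm]

theorem shift_psum (q : K) (I : Finset (Fin n)) (k : ℕ) :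
    shift q I (psum (Fin n) K k) = psum (Fin n) K k + (q ^ k - 1) • ∑ i ∈ I, X i ^ k := by
  rw [psum, map_sum, ← sum_add_sum_compl I, ← sum_add_sum_compl I (fun i => X i ^ k), smul_sum,
    add_right_comm, ← sum_add_distrib]
  congr 1
  · refine sum_congr rfl fun i hi => ?_
    rw [map_pow, shift, aeval_X, if_pos hi, mul_pow, ← C_pow, sub_smul, one_smul, smul_eq_C_mul]
    ring
  · refine sum_congr rfl fun i hi => ?_
    rw [map_pow, shift, aeval_X, if_neg (mem_compl.1 hi)]

/-- Scaling by q changes p_k(x) by (q^k - 1) ∑_{i ∈ I} x_i^k, and the factor (1 - t^k)/(1 - q^k)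
turns q^k - 1 into t^k - 1. So q disappears from the change of the kernel. -/
theorem shiftX_kernelPow {q t : K} (hq : ∀ k : ℕ, 0 < k → q ^ k ≠ 1) (I : Finset (Fin n))
    (k : ℕ) (hk : 0 < k) : shiftX q I (kernelPow q t n k) = kernelPow q t n k +
      (t ^ k - 1) • ∑ p ∈ I ×ˢ (univ : Finset (Fin n)), (X (Sum.inl p.1) * X (Sum.inr p.2)) ^ k := by
  have h1 : 1 - q ^ k ≠ 0 := sub_ne_zero.2 (hq k hk).symm
  have h2 : ((1 - q ^ k) / (1 - t ^ k))⁻¹ * (q ^ k - 1) = t ^ k - 1 := by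
    rw [inv_div, div_mul_eq_mul_div, div_eq_iff h1]; ring
  have h3 : ∑ p ∈ I ×ˢ (univ : Finset (Fin n)), (X (Sum.inl p.1) * X (Sum.inr p.2) : BiPoly K n) ^ k
      = inX K n (∑ i ∈ I, X i ^ k) * inY K n (psum (Fin n) K k) := by
    rw [psum, map_sum, map_sum, sum_mul_sum, sum_product]
    simp [inX, inY, mul_pow]
  rw [kernelPow, map_smul, map_mul, shiftX_inX, shiftX_inY, shift_psum, map_add, map_smul, h3,
    add_mul, smul_add, smul_mul_assoc, smul_smul, h2]

theorem shiftY_kernelPow {q t : K} (hq : ∀ k : ℕ, 0 < k → q ^ k ≠ 1) (I : Finset (Fin n))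
    (k : ℕ) (hk : 0 < k) : shiftY q I (kernelPow q t n k) = kernelPow q t n k +
      (t ^ k - 1) • ∑ p ∈ I ×ˢ (univ : Finset (Fin n)), (X (Sum.inr p.1) * X (Sum.inl p.2)) ^ k := by
  have h1 : 1 - q ^ k ≠ 0 := sub_ne_zero.2 (hq k hk).symm
  have h2 : ((1 - q ^ k) / (1 - t ^ k))⁻¹ * (q ^ k - 1) = t ^ k - 1 := by
    rw [inv_div, div_mul_eq_mul_div, div_eq_iff h1]; ring
  have h3 : ∑ p ∈ I ×ˢ (univ : Finset (Fin n)), (X (Sum.inr p.1) * X (Sum.inl p.2) : BiPoly K n) ^ k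
      = inX K n (psum (Fin n) K k) * inY K n (∑ i ∈ I, X i ^ k) := by
    rw [mul_comm, psum, map_sum, map_sum, sum_mul_sum, sum_product]
    simp [inX, inY, mul_pow]
  rw [kernelPow, map_smul, map_mul, shiftY_inX, shiftY_inY, shift_psum, map_add, map_smul, h3,
    mul_add, smul_add, mul_smul_comm, smul_smul, h2]

/-- The variables `z x_i` in the power series ring. -/
noncomputable def serX (K : Type*) [Field K] {n : ℕ} (i : Fin n) : PowerSeries (BiPoly K n) :=
  PowerSeries.X * PowerSeries.C (X (Sum.inl i))

/-- The variables `y_i` in the power series ring. -/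
noncomputable def serY (K : Type*) [Field K] {n : ℕ} (i : Fin n) : PowerSeries (BiPoly K n) :=
  PowerSeries.C (X (Sum.inr i))

/-- The kernel `∑_d z^d ∑_{|λ| = d} (p_λ, p_λ)⁻¹ p_λ(x) p_λ(y)`. -/
noncomputable def kernelSeries (q t : K) (n : ℕ) : PowerSeries (BiPoly K n) :=
  PowerSeries.mk (partitionSum K (kernelPow q t n))

theorem map_kernelSeries_mul_prod [CharZero K] (q t : K) (I : Finset (Fin n))
    (τ : BiPoly K n →ₐ[K] BiPoly K n) (u v : Fin n → PowerSeries (BiPoly K n))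
    (b : Fin n → Fin n → BiPoly K n) (hb : ∀ i j, u i * v j = PowerSeries.C (b i j) * PowerSeries.X)
    (h : ∀ k, 0 < k → τ (kernelPow q t n k) = kernelPow q t n k +
      (t ^ k - 1) • ∑ p ∈ I ×ˢ (univ : Finset (Fin n)), b p.1 p.2 ^ k) :
    PowerSeries.map (τ : BiPoly K n →+* BiPoly K n) (kernelSeries q t n) *
        ∏ i, ∏ j, (1 - PowerSeries.C (C t) * (u i * v j)) =
      kernelSeries q t n * kernelWeight (PowerSeries.C (C t)) u v I := by
  have h1 := map_partitionSum_mul_prod t (kernelPow q t n) τ (I ×ˢ (univ : Finset (Fin n)))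
    (fun p => b p.1 p.2) h
  have h2 (i j : Fin n) : PowerSeries.C (C t) * (u i * v j) =
      PowerSeries.C (t • b i j) * PowerSeries.X := by
    rw [hb, smul_eq_C_mul, map_mul, mul_assoc]
  simp only [← h2, ← hb, prod_product] at h1
  rw [← prod_mul_prod_compl I, ← mul_assoc, kernelSeries, h1, kernelWeight, mul_assoc]

theorem mul_sum_opD_eq [CharZero K] (q t : K) (d r : ℕ) :
    inX K n (vdm K n) * ∑ lam : Nat.Partition d, (normP q t ⟨d, lam⟩)⁻¹ •
        (inX K n (opD q t n r (psumVars K n lam)) * inY K n (psumVars K n lam)) =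
      ∑ I ∈ powersetCard r univ, inX K n (shift t I (vdm K n)) *
        shiftX q I (partitionSum K (kernelPow q t n) d) := by
  rw [mul_sum]
  simp only [partitionSum_kernelPow, map_sum, mul_sum]
  rw [sum_comm]
  refine sum_congr rfl fun lam _ => ?_
  rw [mul_smul_comm, ← mul_assoc, ← map_mul, vdm_mul_opD, map_sum, sum_mul, smul_sum]
  refine sum_congr rfl fun I _ => ?_
  rw [map_smul, map_mul, map_mul, shiftX_inX, shiftX_inY, mul_smul_comm, mul_assoc]

theorem mul_sum_opD_eq' [CharZero K] (q t : K) (d r : ℕ) :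
    inY K n (vdm K n) * ∑ lam : Nat.Partition d, (normP q t ⟨d, lam⟩)⁻¹ •
        (inX K n (psumVars K n lam) * inY K n (opD q t n r (psumVars K n lam))) =
      ∑ I ∈ powersetCard r univ, inY K n (shift t I (vdm K n)) *
        shiftY q I (partitionSum K (kernelPow q t n) d) := by
  rw [mul_sum]
  simp only [partitionSum_kernelPow, map_sum, mul_sum]
  rw [sum_comm]
  refine sum_congr rfl fun lam _ => ?_
  rw [mul_smul_comm, mul_left_comm, ← map_mul, vdm_mul_opD, map_sum, mul_sum, smul_sum]
  refine sum_congr rfl fun I _ => ?_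
  rw [map_smul, map_mul, map_mul, shiftY_inX, shiftY_inY, mul_smul_comm, mul_left_comm]

theorem ringHom_shift_vdm {S : Type*} [CommRing S] (φ : MvPolynomial (Fin n) K →+* S) (t : K)
    (I : Finset (Fin n)) : φ (shift t I (vdm K n)) =
      (Matrix.vandermonde (scale (φ (C t)) I fun i => φ (X i))).det := by
  rw [vdm, ← AlgHom.coe_toRingHom, map_det_vandermonde, map_det_vandermonde]
  congr 2
  ext i
  by_cases h : i ∈ I <;> simp [shift, scale, h]

/-- The Cauchy identity is applied to z x_i and y_j. The factors 1 - c z x_i y_j have constant term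
1, hence are nonzero, and homogeneity of Δ produces the same power of z on both sides. -/
theorem kernel_vdm_identity [CharZero K] (t : K) (r : ℕ) :
    PowerSeries.C (inY K n (vdm K n)) * ∑ I ∈ powersetCard r univ,
        PowerSeries.C (inX K n (shift t I (vdm K n))) *
          kernelWeight (PowerSeries.C (C t)) (serX K) (serY K) I =
      PowerSeries.C (inX K n (vdm K n)) * ∑ I ∈ powersetCard r univ,
        PowerSeries.C (inY K n (shift t I (vdm K n))) *
          kernelWeight (PowerSeries.C (C t)) (serY K) (serX K) I := by
  have hCinj := PowerSeries.C_injective (R := BiPoly K n)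
  have h1 (c : PowerSeries (BiPoly K n)) (i j : Fin n) : 1 - c * (serX K i * serY K j) ≠ 0 := by
    intro h
    have := congrArg PowerSeries.constantCoeff h
    simp [serX] at this
  have h := sum_vandermonde_kernelWeight_of_isDomain (PowerSeries.C (C t) :
    PowerSeries (BiPoly K n)) (serX K (n := n)) (serY K) r
    (fun i j hij => Sum.inl_injective (X_injective (hCinj
      (mul_left_cancel₀ PowerSeries.X_ne_zero hij))))
    (fun i => mul_ne_zero PowerSeries.X_ne_zero ((map_ne_zero_iff _ hCinj).2 (X_ne_zero _)))
    (fun i j hij => Sum.inr_injective (X_injective (hCinj hij)))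
    (fun i => (map_ne_zero_iff _ hCinj).2 (X_ne_zero _))
    (fun i j => by simpa using h1 1 i j) (fun i j => h1 _ i j)
  have hX (I : Finset (Fin n)) : (Matrix.vandermonde (scale (PowerSeries.C (C t)) I (serX K))).det =
      PowerSeries.X ^ (∑ i : Fin n, (Ioi i).card) *
        PowerSeries.C (inX K n (shift t I (vdm K n))) := by
    have e : PowerSeries.C (inX K n (shift t I (vdm K n))) =
        (Matrix.vandermonde (scale (PowerSeries.C (C t)) I fun i =>
          PowerSeries.C (X (Sum.inl i) : BiPoly K n))).det := by
      refine (ringHom_shift_vdm ((PowerSeries.C (R := BiPoly K n)).comp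
        (inX K n).toRingHom) t I).trans ?_
      simp [inX]
    rw [e, ← det_vandermonde_mul]
    congr 2
    ext1 i
    by_cases h : i ∈ I <;> simp [scale, h, serX, mul_left_comm]
  have hY (I : Finset (Fin n)) : (Matrix.vandermonde (scale (PowerSeries.C (C t)) I (serY K))).det =
      PowerSeries.C (inY K n (shift t I (vdm K n))) := by
    symm
    refine (ringHom_shift_vdm ((PowerSeries.C (R := BiPoly K n)).comp
      (inY K n).toRingHom) t I).trans ?_
    simp only [RingHom.comp_apply, AlgHom.toRingHom_eq_coe, RingHom.coe_coe, inY, rename_C, rename_X]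
    rfl
  have hs (z : Fin n → PowerSeries (BiPoly K n)) : scale (PowerSeries.C (C t)) ∅ z = z := by
    ext1 i; simp [scale]
  -- The empty set gives the unscaled Vandermonde determinants.
  have hX0 := hX ∅
  have hY0 := hY ∅
  rw [hs, shift_empty, AlgHom.id_apply] at hX0 hY0
  simp only [hX, hY, hX0, hY0] at h
  refine mul_left_cancel₀ (pow_ne_zero (∑ i : Fin n, (Ioi i).card)
    (PowerSeries.X_ne_zero (R := BiPoly K n))) ?_
  simp only [mul_assoc, ← mul_sum] at h
  rw [mul_left_comm, h]

/-- The Macdonald operators in the variables `x` and in the variables `y` agree on the kernel. -/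
theorem sum_opD_comm [CharZero K] {q : K} (t : K) (hq : ∀ k : ℕ, 0 < k → q ^ k ≠ 1) (n d r : ℕ) :
    ∑ lam : Nat.Partition d, (normP q t ⟨d, lam⟩)⁻¹ •
        (inX K n (opD q t n r (psumVars K n lam)) * inY K n (psumVars K n lam)) =
      ∑ lam : Nat.Partition d, (normP q t ⟨d, lam⟩)⁻¹ •
        (inX K n (psumVars K n lam) * inY K n (opD q t n r (psumVars K n lam))) := by
  have hvX : inX K n (vdm K n) ≠ 0 := (map_ne_zero_iff _ inX_injective).2 vdm_ne_zero
  have hvY : inY K n (vdm K n) ≠ 0 := (map_ne_zero_iff _ inY_injective).2 vdm_ne_zero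
  refine mul_left_cancel₀ (mul_ne_zero hvX hvY) ?_
  rw [mul_right_comm, mul_sum_opD_eq, mul_assoc (inX K n _), mul_sum_opD_eq', mul_comm]
  -- The identity in all degrees d at once: multiplied by the common denominator ∏(1 - t z x_i y_j),
  -- each shifted kernel becomes the kernel times `kernelWeight`.
  have hser : PowerSeries.C (inY K n (vdm K n)) * ∑ I ∈ powersetCard r univ,
        PowerSeries.C (inX K n (shift t I (vdm K n))) *
          PowerSeries.map (shiftX q I : BiPoly K n →+* BiPoly K n) (kernelSeries q t n) =
      PowerSeries.C (inX K n (vdm K n)) * ∑ I ∈ powersetCard r univ,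
        PowerSeries.C (inY K n (shift t I (vdm K n))) *
          PowerSeries.map (shiftY q I : BiPoly K n →+* BiPoly K n) (kernelSeries q t n) := by
    have hN : ∏ i : Fin n, ∏ j : Fin n,
        (1 - PowerSeries.C (C t) * (serX K i * serY K j)) ≠ 0 := by
      refine prod_ne_zero_iff.2 fun i _ => prod_ne_zero_iff.2 fun j _ h => ?_
      have := congrArg PowerSeries.constantCoeff h
      simp [serX] at this
    have hN' : ∏ i : Fin n, ∏ j : Fin n, (1 - PowerSeries.C (C t) * (serX K i * serY K j)) =
        ∏ i : Fin n, ∏ j : Fin n, (1 - PowerSeries.C (C t) * (serY K i * serX K j)) := by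
      rw [prod_comm]
      exact prod_congr rfl fun i _ => prod_congr rfl fun j _ => by rw [mul_comm (serX K j)]
    refine mul_right_cancel₀ hN ?_
    have eX (I : Finset (Fin n)) : PowerSeries.C (inX K n (shift t I (vdm K n))) *
        PowerSeries.map (shiftX q I : BiPoly K n →+* BiPoly K n) (kernelSeries q t n) *
          ∏ i : Fin n, ∏ j : Fin n, (1 - PowerSeries.C (C t) * (serX K i * serY K j)) =
        kernelSeries q t n * (PowerSeries.C (inX K n (shift t I (vdm K n))) *
          kernelWeight (PowerSeries.C (C t)) (serX K) (serY K) I) := by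
      rw [mul_assoc, map_kernelSeries_mul_prod q t I (shiftX q I) (serX K) (serY K)
        (fun i j => X (Sum.inl i) * X (Sum.inr j))
        (fun i j => by rw [serX, serY, map_mul]; ring) (shiftX_kernelPow hq I), mul_left_comm]
    have eY (I : Finset (Fin n)) : PowerSeries.C (inY K n (shift t I (vdm K n))) *
        PowerSeries.map (shiftY q I : BiPoly K n →+* BiPoly K n) (kernelSeries q t n) *
          ∏ i : Fin n, ∏ j : Fin n, (1 - PowerSeries.C (C t) * (serX K i * serY K j)) =
        kernelSeries q t n * (PowerSeries.C (inY K n (shift t I (vdm K n))) *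
          kernelWeight (PowerSeries.C (C t)) (serY K) (serX K) I) := by
      rw [mul_assoc, hN', map_kernelSeries_mul_prod q t I (shiftY q I) (serY K) (serX K)
        (fun i j => X (Sum.inr i) * X (Sum.inl j))
        (fun i j => by rw [serX, serY, map_mul]; ring) (shiftY_kernelPow hq I), mul_left_comm]
    rw [mul_assoc, mul_assoc, sum_mul, sum_mul, sum_congr rfl fun I _ => eX I,
      sum_congr rfl fun I _ => eY I, ← mul_sum, ← mul_sum, mul_left_comm, kernel_vdm_identity,
      mul_left_comm]
  have h := congrArg (PowerSeries.coeff d) hser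
  simpa only [PowerSeries.coeff_C_mul, map_sum, PowerSeries.coeff_map, kernelSeries,
    PowerSeries.coeff_mk, RingHom.coe_coe] using h

theorem sum_opE_comm [CharZero K] {q : K} (t : K) (hq : ∀ k : ℕ, 0 < k → q ^ k ≠ 1) (n d r : ℕ) :
    ∑ lam : Nat.Partition d, (normP q t ⟨d, lam⟩)⁻¹ •
        (inX K n (opE q t n r (psumVars K n lam)) * inY K n (psumVars K n lam)) =
      ∑ lam : Nat.Partition d, (normP q t ⟨d, lam⟩)⁻¹ •
        (inX K n (psumVars K n lam) * inY K n (opE q t n r (psumVars K n lam))) := by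
  have h (lam : Nat.Partition d) : (opE q t n r (psumVars K n lam) : MvPolynomial (Fin n) K) =
      ∑ j ∈ range (r + 1), (coeffE t n j * t⁻¹ ^ ((r - j) * n)) •
        (opD q t n (r - j) (psumVars K n lam) : MvPolynomial (Fin n) K) := by
    rw [opE_apply, AddSubmonoidClass.coe_finsetSum]
    exact sum_congr rfl fun j _ => by rw [smul_smul]; rfl
  simp only [h, map_sum, map_smul, sum_mul, mul_sum, smul_sum]
  rw [sum_comm, sum_comm (s := univ)]
  refine sum_congr rfl fun j _ => ?_
  simp only [smul_mul_assoc, mul_smul_comm, smul_comm _ (coeffE t n j * t⁻¹ ^ ((r - j) * n))]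
  rw [← smul_sum, ← smul_sum, sum_opD_comm t hq]

/-! ### From the kernel identity to matrix coefficients -/

theorem exists_functional_mul (φ ψ : MvPolynomial (Fin n) K →ₗ[K] K) :
    ∃ Φ : BiPoly K n →ₗ[K] K, ∀ f g, Φ (inX K n f * inY K n g) = φ f * ψ g := by
  let e := MvPolynomial.tensorEquivSum K (Fin n) (Fin n) K
  refine ⟨LinearMap.mul' K K ∘ₗ TensorProduct.map φ ψ ∘ₗ e.symm.toLinearMap, fun f g => ?_⟩
  have hf : e (f ⊗ₜ 1) = inX K n f := by
    have : e.toAlgHom.comp Algebra.TensorProduct.includeLeft = inX K n := by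
      ext i : 1
      simp [e, inX]
    exact congrArg (fun χ => χ f) this
  have hg : e (1 ⊗ₜ g) = inY K n g := by
    have : e.toAlgHom.comp Algebra.TensorProduct.includeRight = inY K n := by
      ext i : 1
      simp [e, inY]
    exact congrArg (fun χ => χ g) this
  have h : inX K n f * inY K n g = e (f ⊗ₜ g) := by
    rw [← hf, ← hg, ← map_mul, Algebra.TensorProduct.tmul_mul_tmul, mul_one, one_mul]
  rw [h]
  simp

/-- On Λ_n take the coefficient of the corresponding monomial under the inverse of `psumHom`, then
extend linearly to all polynomials. Such functionals read matrix coefficients off the kernel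
identity. -/
theorem exists_powerSum_functional [CharZero K] (lam : Ptn) (hlam : ∀ k ∈ lam.2.parts, k ≤ n) :
    ∃ φ : MvPolynomial (Fin n) K →ₗ[K] K, ∀ ν : Ptn, (∀ k ∈ ν.2.parts, k ≤ n) →
      φ (toVars K n (powerSumPart K ν)) = if ν = lam then 1 else 0 := by
  let e := AlgEquiv.ofBijective (psumHom K n) ⟨psumHom_injective, psumHom_surjective⟩
  obtain ⟨φ, hφ⟩ := LinearMap.exists_extend (p := Subalgebra.toSubmodule (SymPoly K n))
    (lcoeff K (mult n lam) ∘ₗ e.symm.toLinearMap)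
  refine ⟨φ, fun ν hν => ?_⟩
  have h := LinearMap.congr_fun hφ (toVars K n (powerSumPart K ν))
  refine h.trans ?_
  have h2 : e.symm (toVars K n (powerSumPart K ν)) = monomial (mult n ν) 1 := by
    rw [AlgEquiv.symm_apply_eq, ← psumHom_monomial ν hν]
    rfl
  show coeff (mult n lam) (e.symm (toVars K n (powerSumPart K ν))) = _
  rw [h2, coeff_monomial]
  congr 1
  exact propext ⟨fun h => mult_injOn hν hlam h, fun h => by rw [h]⟩

/-- The matrix of `E^r` in the basis of power sums. -/
theorem repr_limE_powerSum [CharZero K] {q t : K} (ht0 : t ≠ 0) (hq : ∀ k : ℕ, 0 < k → q ^ k ≠ 1)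
    (r : ℕ) (lam μ : Ptn) :
    (normP q t lam)⁻¹ * (powerSumBasis K).repr (limE q ht0 r (powerSumPart K lam)) μ =
      if μ.1 = lam.1 then
        (normP q t μ)⁻¹ * (powerSumBasis K).repr (limE q ht0 r (powerSumPart K μ)) lam else 0 := by
  obtain ⟨d, lam⟩ := lam
  let S : Nat.Partition d → Finset Ptn := fun ν =>
    ((powerSumBasis K).repr (limE q ht0 r (powerSumPart K ⟨d, ν⟩))).support
  -- Enough variables for λ, μ and every p_κ occurring in some E^r p_ν with |ν| = d.
  let n := d + μ.1 + univ.sup fun ν => (S ν).sup Sigma.fst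
  have hle (ν : Ptn) (h : ν.1 ≤ n) : ∀ k ∈ ν.2.parts, k ≤ n :=
    fun k hk => (part_le_size ν k hk).trans h
  have hd : d ≤ n := by omega
  obtain ⟨φ, hφ⟩ := exists_powerSum_functional (K := K) μ (hle μ (by omega))
  obtain ⟨ψ, hψ⟩ := exists_powerSum_functional (K := K) ⟨d, lam⟩ (hle ⟨d, lam⟩ hd)
  obtain ⟨Φ, hΦ⟩ := exists_functional_mul φ ψ
  have hval (χ : MvPolynomial (Fin n) K →ₗ[K] K) (κ : Ptn)
      (hχ : ∀ ν : Ptn, (∀ k ∈ ν.2.parts, k ≤ n) →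
        χ (toVars K n (powerSumPart K ν)) = if ν = κ then 1 else 0) (ν : Nat.Partition d) :
      χ (opE q t n r (psumVars K n ν)) =
        (powerSumBasis K).repr (limE q ht0 r (powerSumPart K ⟨d, ν⟩)) κ := by
    rw [psumVars, ← toVars_limE q ht0]
    set g := limE q ht0 r (powerSumPart K ⟨d, ν⟩) with hg
    have hsum := (powerSumBasis K).linearCombination_repr g
    rw [Finsupp.linearCombination_apply, Finsupp.sum] at hsum
    conv_lhs => rw [← hsum, map_sum, AddSubmonoidClass.coe_finsetSum, map_sum]
    have : ∀ i ∈ ((powerSumBasis K).repr g).support,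
        χ (toVars K n ((powerSumBasis K).repr g i • powerSumBasis K i) : MvPolynomial (Fin n) K) =
          if i = κ then (powerSumBasis K).repr g i else 0 := by
      intro i hi
      have hi' : i.1 ≤ n := by
        have h1 : i.1 ≤ (S ν).sup Sigma.fst := le_sup (f := Sigma.fst) hi
        have h2 : (S ν).sup Sigma.fst ≤ univ.sup fun ν => (S ν).sup Sigma.fst :=
          le_sup (f := fun ν => (S ν).sup Sigma.fst) (mem_univ ν)
        omega
      rw [powerSumBasis_apply, map_smul, SetLike.val_smul, map_smul, hχ i (hle i hi')]
      simp
    rw [sum_congr rfl this, sum_ite_eq']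
    split_ifs with h
    · rfl
    · exact (Finsupp.notMem_support_iff.1 h).symm
  -- Applying φ in x and ψ in y leaves only ν = λ on the left, and only ν = μ on the right, which is
  -- absent when |μ| ≠ d.
  have key := congrArg Φ (sum_opE_comm t hq n d r)
  simp only [map_sum, map_smul, hΦ, hval φ μ hφ, hval ψ _ hψ] at key
  simp only [psumVars] at key
  have e1 : ∀ ν : Nat.Partition d, ψ (toVars K n (powerSumPart K ⟨d, ν⟩)) =
      if ν = lam then 1 else 0 := fun ν => by
    rw [hψ _ (hle ⟨d, ν⟩ hd)]
    simp
  have e2 : ∀ ν : Nat.Partition d, φ (toVars K n (powerSumPart K ⟨d, ν⟩)) =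
      if (⟨d, ν⟩ : Ptn) = μ then 1 else 0 := fun ν => hφ _ (hle ⟨d, ν⟩ hd)
  simp only [e1, e2, smul_eq_mul, mul_ite, mul_one, mul_zero, ite_mul, one_mul, zero_mul,
    sum_ite_eq', mem_univ, if_true] at key
  rw [key]
  obtain ⟨e, μ⟩ := μ
  simp only
  split_ifs with h
  · subst h
    simp
  · refine sum_eq_zero fun ν _ => if_neg fun h' => h (congrArg Sigma.fst h').symm

theorem scalarForm_limE_comm [CharZero K] {q t : K} (ht0 : t ≠ 0)
    (hq : ∀ k : ℕ, 0 < k → q ^ k ≠ 1) (ht : ∀ k : ℕ, 0 < k → t ^ k ≠ 1) (r : ℕ) (f g : SymFun K) :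
    scalarForm q t (limE q ht0 r f) g = scalarForm q t f (limE q ht0 r g) := by
  suffices h : scalarForm q t ∘ₗ limE q ht0 r = (scalarForm q t).compl₂ (limE q ht0 r) by
    exact congrArg (fun B => B f g) h
  refine (powerSumBasis K).ext fun lam => (powerSumBasis K).ext fun μ => ?_
  rw [LinearMap.comp_apply, LinearMap.compl₂_apply, powerSumBasis_apply, powerSumBasis_apply,
    scalarForm_comm, scalarForm_powerSum_left, scalarForm_powerSum_left]
  have h1 := repr_limE_powerSum ht0 hq r lam μ
  have h2 := repr_limE_powerSum ht0 hq r μ lam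
  have n1 := normP_ne_zero hq ht lam
  have n2 := normP_ne_zero hq ht μ
  by_cases h : μ.1 = lam.1
  · rw [if_pos h] at h1
    field_simp at h1
    linear_combination h1
  · rw [if_neg h] at h1
    rw [if_neg (Ne.symm h)] at h2
    rw [(mul_eq_zero.1 h1).resolve_left (inv_ne_zero n1),
      (mul_eq_zero.1 h2).resolve_left (inv_ne_zero n2), zero_mul, zero_mul]

end Macdonald

namespace Macdonald
open Finset
open scoped MonomialOrder

/-! ### Triangularity with respect to the lexicographic order -/

variable {K : Type*} [Field K] {n : ℕ}

theorem degree_X_sub_X {i j : Fin n} (h : i < j) :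
    MonomialOrder.lex.degree (X j - X i : MvPolynomial (Fin n) K) = Finsupp.single i 1 := by
  rw [← neg_sub, MonomialOrder.degree_neg, MonomialOrder.degree_sub_of_lt, MonomialOrder.degree_X]
  rw [MonomialOrder.degree_X, MonomialOrder.degree_X, MonomialOrder.lex_lt_iff,
    Finsupp.Lex.single_lt_iff]
  exact h

/-- Earlier variables are larger, so x_j - x_i with i < j has leading monomial x_i, and the leading
exponent of Δ is the staircase. -/
theorem degree_vdm_apply (i : Fin n) : MonomialOrder.lex.degree (vdm K n) i = n - 1 - i := by
  have h (i j : Fin n) (hj : j ∈ Ioi i) : (X j - X i : MvPolynomial (Fin n) K) ≠ 0 :=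
    X_sub_X_ne_zero (mem_Ioi.1 hj).ne'
  rw [vdm, Matrix.det_vandermonde, MonomialOrder.degree_prod fun i _ => prod_ne_zero_iff.2 (h i)]
  have h2 (i : Fin n) : MonomialOrder.lex.degree (∏ j ∈ Ioi i, (X j - X i : MvPolynomial (Fin n) K)) =
      Finsupp.single i (n - 1 - i) := by
    rw [MonomialOrder.degree_prod (h i), sum_congr rfl fun j hj => degree_X_sub_X (mem_Ioi.1 hj),
      sum_const, Fin.card_Ioi, Finsupp.smul_single, smul_eq_mul, mul_one]
  simp only [h2, Finsupp.finsetSum_apply]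
  rw [sum_eq_single i (fun j _ hj => Finsupp.single_eq_of_ne hj.symm) (by simp), Finsupp.single_eq_same]

theorem degree_shift_le (q : K) (I : Finset (Fin n)) (f : MvPolynomial (Fin n) K) :
    MonomialOrder.lex.degree (shift q I f) ≼[MonomialOrder.lex] MonomialOrder.lex.degree f :=
  MonomialOrder.degree_le_degree_of_support_subset (support_shift_subset q I f)

theorem degree_sum_le_of_forall_le {ι : Type*} {s : Finset ι} {f : ι → MvPolynomial (Fin n) K}
    {α : Fin n →₀ ℕ} (h : ∀ i ∈ s, MonomialOrder.lex.degree (f i) ≼[MonomialOrder.lex] α) :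
    MonomialOrder.lex.degree (∑ i ∈ s, f i) ≼[MonomialOrder.lex] α :=
  MonomialOrder.degree_sum_le.trans (Finset.sup_le h)

theorem degree_opD_le [CharZero K] (q t : K) (r : ℕ) (f : SymPoly K n) {α : Fin n →₀ ℕ}
    (hf : MonomialOrder.lex.degree (f : MvPolynomial (Fin n) K) ≼[MonomialOrder.lex] α) :
    MonomialOrder.lex.degree (opD q t n r f : MvPolynomial (Fin n) K) ≼[MonomialOrder.lex] α := by
  by_cases h0 : (opD q t n r f : MvPolynomial (Fin n) K) = 0
  · rw [h0, MonomialOrder.degree_zero, map_zero]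
    exact MonomialOrder.zero_le _ _
  have h := MonomialOrder.degree_mul (m := MonomialOrder.lex) (vdm_ne_zero (K := K) (n := n)) h0
  rw [vdm_mul_opD] at h
  have h2 : MonomialOrder.lex.degree (∑ I ∈ powersetCard r univ, shift t I (vdm K n) *
      shift q I (f : MvPolynomial (Fin n) K)) ≼[MonomialOrder.lex]
      MonomialOrder.lex.degree (vdm K n) + α := by
    refine degree_sum_le_of_forall_le fun I _ => MonomialOrder.degree_mul_le.trans ?_
    rw [map_add, map_add]
    exact add_le_add (degree_shift_le _ _ _) ((degree_shift_le _ _ _).trans hf)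
  rw [h, map_add, map_add] at h2
  exact le_of_add_le_add_left h2

/-- At the exponent deg Δ + α only the coefficients at deg Δ and at α enter each product in
`vdm_mul_opD`. Scaling multiplies them by powers of t and q, and the coefficient of Δ cancels. -/
theorem coeff_opD [CharZero K] (q t : K) (r : ℕ) (f : SymPoly K n) {α : Fin n →₀ ℕ}
    (hf : MonomialOrder.lex.degree (f : MvPolynomial (Fin n) K) ≼[MonomialOrder.lex] α) :
    coeff α (opD q t n r f : MvPolynomial (Fin n) K) =
      (∑ I ∈ powersetCard r univ, ∏ i ∈ I, (t ^ (n - 1 - i.1) * q ^ α i)) *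
        coeff α (f : MvPolynomial (Fin n) K) := by
  have hv : coeff (MonomialOrder.lex.degree (vdm K n)) (vdm K n) ≠ 0 :=
    MonomialOrder.coeff_degree_ne_zero_iff.2 vdm_ne_zero
  refine mul_left_cancel₀ hv ?_
  rw [← MonomialOrder.coeff_mul_of_add_of_degree_le (m := MonomialOrder.lex) le_rfl
    (degree_opD_le q t r f hf), vdm_mul_opD, coeff_sum, sum_mul, mul_sum]
  refine sum_congr rfl fun I _ => ?_
  rw [MonomialOrder.coeff_mul_of_add_of_degree_le (m := MonomialOrder.lex) (degree_shift_le _ _ _)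
    ((degree_shift_le _ _ _).trans hf), coeff_shift, coeff_shift, ← prod_pow_eq_pow_sum,
    ← prod_pow_eq_pow_sum, prod_mul_distrib]
  simp only [degree_vdm_apply]
  ring

theorem esymmFirst_eq_sum (y : ℕ → K) (n k : ℕ) :
    esymmFirst y n k = ∑ I ∈ powersetCard k (univ : Finset (Fin n)), ∏ i ∈ I, y i := by
  rw [esymmFirst, ← Finset.range_val, Finset.esymm_map_val,
    show range n = (univ : Finset (Fin n)).map Fin.valEmbedding by rw [Fin.map_valEmbedding_univ]; ext; simp,
    powersetCard_map, sum_map]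
  refine sum_congr rfl fun I _ => ?_
  rw [RelEmbedding.coe_toEmbedding, mapEmbedding_apply, prod_map]
  rfl

/-- The exponents `(μ_1, …, μ_n)`. -/
noncomputable def partExp (n : ℕ) (μ : Ptn) : Fin n →₀ ℕ :=
  Finsupp.equivFunOnFinite.symm fun i => μ.part i

theorem partExp_apply (μ : Ptn) (i : Fin n) : partExp n μ i = μ.part i := rfl

/-- Each of the k factors absorbs one t^{-n}, turning t^{n-1-i} into t^{-(i+1)}. -/
theorem sum_prod_partExp {q t : K} (ht0 : t ≠ 0) (μ : Ptn) (k : ℕ) :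
    t⁻¹ ^ (k * n) * (∑ I ∈ powersetCard k univ, ∏ i ∈ I, (t ^ (n - 1 - i.1) * q ^ partExp n μ i)) =
      esymmFirst (spec q t μ) n k := by
  rw [esymmFirst_eq_sum, mul_sum]
  refine sum_congr rfl fun I hI => ?_
  rw [mul_comm k, pow_mul, ← (mem_powersetCard.1 hI).2, ← prod_const, ← prod_mul_distrib]
  refine prod_congr rfl fun i _ => ?_
  have h : t⁻¹ ^ n = t⁻¹ ^ (n - 1 - i.1) * t⁻¹ ^ (i.1 + 1) := by
    rw [← pow_add]
    congr 1
    omega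
  rw [spec, partExp_apply, h, inv_pow, inv_pow]
  field_simp

theorem degree_opE_le [CharZero K] (q t : K) (r : ℕ) (f : SymPoly K n) {α : Fin n →₀ ℕ}
    (hf : MonomialOrder.lex.degree (f : MvPolynomial (Fin n) K) ≼[MonomialOrder.lex] α) :
    MonomialOrder.lex.degree (opE q t n r f : MvPolynomial (Fin n) K) ≼[MonomialOrder.lex] α := by
  rw [opE, LinearMap.sum_apply, AddSubmonoidClass.coe_finsetSum]
  refine degree_sum_le_of_forall_le fun j _ => ?_
  rw [LinearMap.smul_apply, SetLike.val_smul]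
  exact MonomialOrder.degree_smul_le.trans (degree_opD_le q t _ f hf)

theorem coeff_opE [CharZero K] {q t : K} (ht0 : t ≠ 0) (r : ℕ) (f : SymPoly K n) {μ : Ptn}
    (hf : MonomialOrder.lex.degree (f : MvPolynomial (Fin n) K) ≼[MonomialOrder.lex] partExp n μ) :
    coeff (partExp n μ) (opE q t n r f : MvPolynomial (Fin n) K) =
      eigE q t n r μ * coeff (partExp n μ) (f : MvPolynomial (Fin n) K) := by
  rw [opE_apply, AddSubmonoidClass.coe_finsetSum, coeff_sum, eigE, sum_mul]
  refine sum_congr rfl fun j _ => ?_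
  rw [SetLike.val_smul, SetLike.val_smul, coeff_smul, coeff_smul, coeff_opD q t _ f hf, smul_eq_mul,
    smul_eq_mul, ← sum_prod_partExp ht0, coeffE]
  ring

/-! ### Monomial symmetric polynomials -/

/-- The partition formed by the nonzero values of `α`. -/
def shape (α : Fin n →₀ ℕ) : Ptn :=
  ⟨_, Nat.Partition.ofSums _ ((univ : Finset (Fin n)).val.map α) rfl⟩

theorem shape_parts (α : Fin n →₀ ℕ) :
    (shape α).2.parts = ((univ : Finset (Fin n)).val.map α).filter (· ≠ 0) := rfl

theorem getD_filter_ne_zero (l : List ℕ) (hl : l.Pairwise (· ≥ ·)) (i : ℕ) :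
    (l.filter (· ≠ 0)).getD i 0 = l.getD i 0 := by
  induction l generalizing i with
  | nil => simp
  | cons a l ih =>
    rw [List.pairwise_cons] at hl
    by_cases ha : a = 0
    · have h0 : ∀ b ∈ l, b = 0 := fun b hb => by have := hl.1 b hb; omega
      have hf : (a :: l).filter (· ≠ 0) = [] := by
        rw [List.filter_eq_nil_iff]
        intro b hb
        rcases List.mem_cons.1 hb with rfl | hb
        · simp [ha]
        · simp [h0 b hb]
      rw [hf, List.getD_nil]
      rcases i with _ | i
      · simp [ha]
      · rw [List.getD_cons_succ, ← ih hl.2, List.filter_eq_nil_iff.2, List.getD_nil]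
        intro b hb
        simp [h0 b hb]
    · rw [List.filter_cons_of_pos (by simpa using ha)]
      rcases i with _ | i
      · simp
      · rw [List.getD_cons_succ, List.getD_cons_succ, ih hl.2]

theorem coe_ofFn_eq (α : Fin n → ℕ) :
    ((List.ofFn α : List ℕ) : Multiset ℕ) = (univ : Finset (Fin n)).val.map α :=
  (Fin.univ_val_map α).symm

theorem partExp_shape (α : Fin n →₀ ℕ) (hα : Antitone α) : partExp n (shape α) = α := by
  ext i
  have hs : (List.ofFn α).Pairwise (· ≥ ·) := by
    rw [List.pairwise_ofFn]
    exact fun i j hij => hα hij.le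
  rw [partExp_apply, Ptn.part, shape_parts, ← coe_ofFn_eq, Multiset.filter_coe, Multiset.coe_sort,
    List.mergeSort_eq_self _ (hs.filter _), getD_filter_ne_zero _ hs]
  simp

theorem shape_partExp (μ : Ptn) (h : μ.length ≤ n) : shape (partExp n μ) = μ := by
  refine Ptn.ext ?_
  have hlen : (μ.2.parts.sort (· ≥ ·)).length ≤ n := by rw [Multiset.length_sort]; exact h
  have h1 : List.ofFn (partExp n μ) = μ.2.parts.sort (· ≥ ·) ++
      List.replicate (n - (μ.2.parts.sort (· ≥ ·)).length) 0 := by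
    refine List.ext_getElem (by
      rw [List.length_ofFn, List.length_append, List.length_replicate]; omega) fun i h1 h2 => ?_
    rw [List.getElem_ofFn, partExp_apply, Ptn.part]
    rw [List.getElem_append]
    split_ifs with hi
    · exact List.getD_eq_getElem _ _ hi
    · rw [List.getElem_replicate, List.getD_eq_default]
      simpa using hi
  rw [shape_parts, ← coe_ofFn_eq, h1, ← Multiset.coe_add, Multiset.sort_eq, Multiset.filter_add,
    Multiset.filter_eq_self.2 fun k hk => (μ.2.parts_pos hk).ne', Multiset.filter_eq_nil.2, add_zero]
  intro k hk
  simpa using (List.eq_of_mem_replicate (Multiset.mem_coe.1 hk))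

theorem ofSym_parts_eq {d : ℕ} (s : Sym (Fin n) d) :
    (Nat.Partition.ofSym s).parts = (shape (Multiset.toFinsupp s.1)).2.parts := by
  rw [shape_parts, Multiset.filter_map, ← Finset.filter_val]
  show s.1.dedup.map s.1.count = _
  have h : univ.filter ((· ≠ 0) ∘ (Multiset.toFinsupp s.1)) = s.1.toFinset := by
    ext i
    rw [mem_filter, Multiset.mem_toFinset, Function.comp_apply, Multiset.toFinsupp_apply,
      Multiset.count_ne_zero]
    simp
  rw [h, Multiset.toFinset_val]
  exact Multiset.map_congr rfl fun i _ => (Multiset.toFinsupp_apply _ _).symm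

theorem prod_map_X (s : Multiset (Fin n)) :
    (s.map X).prod = (monomial (Multiset.toFinsupp s) 1 : MvPolynomial (Fin n) K) := by
  induction s using Multiset.induction_on with
  | empty => simp
  | cons i s ih =>
    rw [Multiset.map_cons, Multiset.prod_cons, ih, ← Multiset.singleton_add, map_add, X,
      monomial_mul, one_mul, Multiset.toFinsupp_singleton]

theorem coeff_msymm {d : ℕ} (μ : Nat.Partition d) (α : Fin n →₀ ℕ) :
    coeff α (msymm (Fin n) K μ) = if shape α = ⟨d, μ⟩ then 1 else 0 := by
  rw [msymm, coeff_sum]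
  simp only [prod_map_X, coeff_monomial]
  split_ifs with h
  · have hd : (shape α).1 = d := by rw [h]
    have hcard : (Multiset.toFinsupp.symm α).card = d := by
      rw [← hd, Multiset.toFinsupp_symm_apply, Finsupp.card_toMultiset, Finsupp.sum_fintype _ _ (by simp)]
      rfl
    let s₀ : Sym (Fin n) d := Sym.mk (Multiset.toFinsupp.symm α) hcard
    have hs₀ : Multiset.toFinsupp s₀.1 = α := AddEquiv.apply_symm_apply _ _
    have hs : Nat.Partition.ofSym s₀ = μ := by
      refine Nat.Partition.ext ?_
      rw [ofSym_parts_eq, hs₀, h]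
    rw [Fintype.sum_eq_single (⟨s₀, hs⟩ : {a : Sym (Fin n) d // Nat.Partition.ofSym a = μ})]
    · rw [if_pos hs₀]
    · intro s hne
      refine if_neg fun h => hne (Subtype.ext (Sym.coe_injective ?_))
      exact Multiset.toFinsupp.injective (h.trans hs₀.symm)
  · refine sum_eq_zero fun s _ => if_neg fun hs => h (Ptn.ext ?_)
    have := ofSym_parts_eq s.1
    rw [s.2, hs] at this
    exact this.symm

theorem totalDegree_msymm_le {d : ℕ} (μ : Nat.Partition d) :
    (msymm (Fin n) K μ).totalDegree ≤ d := by
  refine totalDegree_finsetSum_le fun s _ => ?_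
  rw [prod_map_X]
  refine (totalDegree_monomial_le _ _).trans ?_
  conv_rhs => rw [← s.1.2]
  rw [← Multiset.toFinsupp_toMultiset s.1.1, Finsupp.card_toMultiset, Multiset.toFinsupp_toMultiset]

/-- At the first index where the exponents differ the earlier partial sums agree, so dominance
decides the comparison. -/
theorem partExp_le_of_dominated {d : ℕ} {μ lam : Nat.Partition d} (h : Dominated μ lam) :
    partExp n ⟨d, μ⟩ ≼[MonomialOrder.lex] partExp n ⟨d, lam⟩ := by
  by_contra hlt
  rw [not_le, MonomialOrder.lex_lt_iff, Finsupp.Lex.lt_iff] at hlt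
  obtain ⟨i, hj, hi⟩ := hlt
  simp only [ofLex_toLex, partExp_apply] at hj hi
  have h2 := h.2 (i.1 + 1)
  have h3 : ∑ j ∈ range i.1, Ptn.part ⟨d, lam⟩ j = ∑ j ∈ range i.1, Ptn.part ⟨d, μ⟩ j :=
    sum_congr rfl fun j hj' => hj ⟨j, (mem_range.1 hj').trans i.2⟩ (mem_range.1 hj')
  rw [sum_range_succ, sum_range_succ] at h2
  omega

theorem antitone_degree {f : MvPolynomial (Fin n) K} (hf : f.IsSymmetric) :
    Antitone (MonomialOrder.lex.degree f) := hf.antitone_supDegree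

/-! ### Macdonald functions -/

variable {q t : K} {P : Ptn → SymFun K}

theorem IsMacdonald.degLE (hP : IsMacdonald q t P) (μ : Ptn) : DegLE μ.1 (P μ) := by
  obtain ⟨d, μ⟩ := μ
  obtain ⟨u, _, hu⟩ := hP.triangular d μ
  intro n
  rw [hu]
  refine (totalDegree_add _ _).trans (max_le (totalDegree_msymm_le _) ?_)
  exact totalDegree_finsetSum_le fun ν _ =>
    (totalDegree_smul_le _ _).trans (totalDegree_msymm_le _)

theorem IsMacdonald.coeff_partExp (hP : IsMacdonald q t P) (μ : Ptn) (hn : μ.length ≤ n) :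
    coeff (partExp n μ) (toVars K n (P μ) : MvPolynomial (Fin n) K) = 1 := by
  obtain ⟨d, μ⟩ := μ
  obtain ⟨u, hdom, hu⟩ := hP.triangular d μ
  rw [hu, coeff_add, coeff_sum, coeff_msymm, shape_partExp _ hn, if_pos rfl, sum_eq_zero, add_zero]
  intro ν _
  rw [coeff_smul, coeff_msymm, shape_partExp _ hn]
  by_cases h : μ = ν
  · subst h
    have : u μ = 0 := by_contra fun h => (hdom μ h).1 rfl
    rw [this, zero_smul]
  · rw [if_neg (fun h' => h (by simpa using h')), smul_zero]

/-- The leading exponent of a symmetric polynomial is decreasing, hence comes from a partition; its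
coefficient is nonzero only if that partition is μ or is dominated by μ. No bound on the length is
needed. -/
theorem IsMacdonald.degree_le (hP : IsMacdonald q t P) (μ : Ptn) :
    MonomialOrder.lex.degree (toVars K n (P μ) : MvPolynomial (Fin n) K)
      ≼[MonomialOrder.lex] partExp n μ := by
  set F := (toVars K n (P μ) : MvPolynomial (Fin n) K) with hF
  by_cases h0 : F = 0
  · rw [h0, MonomialOrder.degree_zero, map_zero]
    exact MonomialOrder.zero_le _ _
  have hanti : Antitone (MonomialOrder.lex.degree F) := antitone_degree (toVars K n (P μ)).2
  have hc : coeff (MonomialOrder.lex.degree F) F ≠ 0 := MonomialOrder.coeff_degree_ne_zero_iff.2 h0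
  have hshape := partExp_shape _ hanti
  obtain ⟨d, μ⟩ := μ
  obtain ⟨u, hdom, hu⟩ := hP.triangular d μ
  generalize hβ : MonomialOrder.lex.degree F = β at *
  rw [hF, hu, coeff_add, coeff_sum, coeff_msymm] at hc
  by_cases h1 : shape β = ⟨d, μ⟩
  · rw [← h1, hshape]
  · rw [if_neg h1, zero_add] at hc
    obtain ⟨ν, _, hν⟩ := exists_ne_zero_of_sum_ne_zero hc
    rw [coeff_smul, coeff_msymm] at hν
    have h2 : shape β = ⟨d, ν⟩ := by
      by_contra h2
      rw [if_neg h2, smul_zero] at hν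
      exact hν rfl
    rw [← hshape, h2]
    exact partExp_le_of_dominated (hdom ν (left_ne_zero_of_smul hν))

end Macdonald

namespace Macdonald
open Finset
open scoped MonomialOrder

variable {K : Type*} [Field K] {n : ℕ} {q t : K} {P : Ptn → SymFun K}

/-! ### Expansion in Macdonald functions -/

theorem length_shape_le (α : Fin n →₀ ℕ) : (shape α).length ≤ n := by
  rw [Ptn.length, shape_parts]
  refine (Multiset.card_le_card (Multiset.filter_le _ _)).trans ?_
  simp

theorem length_le_size (μ : Ptn) : μ.length ≤ μ.1 := by
  have h := Multiset.card_nsmul_le_sum (s := μ.2.parts) (a := 1) fun k hk => μ.2.parts_pos hk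
  rw [μ.2.parts_sum, smul_eq_mul, mul_one] at h
  exact h

theorem degree_lt_of_coeff_eq_zero {f : MvPolynomial (Fin n) K} {α : Fin n →₀ ℕ} (h0 : f ≠ 0)
    (h : MonomialOrder.lex.degree f ≼[MonomialOrder.lex] α) (hc : coeff α f = 0) :
    MonomialOrder.lex.degree f ≺[MonomialOrder.lex] α := by
  refine lt_of_le_of_ne h fun heq => ?_
  rw [← MonomialOrder.lex.toSyn.injective heq] at hc
  exact MonomialOrder.coeff_degree_ne_zero_iff.2 h0 hc

theorem degree_add_smul_le {f g : MvPolynomial (Fin n) K} {α : Fin n →₀ ℕ} (c : K)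
    (hf : MonomialOrder.lex.degree f ≼[MonomialOrder.lex] α)
    (hg : MonomialOrder.lex.degree g ≼[MonomialOrder.lex] α) :
    MonomialOrder.lex.degree (f + c • g) ≼[MonomialOrder.lex] α :=
  MonomialOrder.degree_add_le.trans (sup_le hf (MonomialOrder.degree_smul_le.trans hg))

/-- Induct on the leading exponent β, subtracting the leading coefficient times the P_μ with leading
exponent β. Since |μ| ≤ d ≤ n, the remainder still has degree at most d and is determined by its
image in n variables. -/
theorem IsMacdonald.mem_span (hP : IsMacdonald q t P) {d : ℕ} (hd : d ≤ n) (f : SymFun K)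
    (hf : DegLE d f) : f ∈ Submodule.span K (P '' {μ | partExp n μ ≼[MonomialOrder.lex]
      MonomialOrder.lex.degree (toVars K n f : MvPolynomial (Fin n) K)}) := by
  induction hs : MonomialOrder.lex.toSyn (MonomialOrder.lex.degree
    (toVars K n f : MvPolynomial (Fin n) K)) using WellFoundedLT.induction generalizing f with
  | _ s ih =>
    by_cases h0 : toVars K n f = 0
    · rw [eq_zero_of_toVars_eq_zero hd hf h0]
      exact Submodule.zero_mem _
    set F := (toVars K n f : MvPolynomial (Fin n) K) with hF
    have hF0 : F ≠ 0 := fun h => h0 (Subtype.ext h)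
    set β := MonomialOrder.lex.degree F with hβ
    have hanti : Antitone β := antitone_degree (toVars K n f).2
    have hshape := partExp_shape β hanti
    have hsize : (shape β).1 ≤ d := by
      refine le_trans ?_ (hf n)
      refine le_trans (le_of_eq ?_) (le_totalDegree (MonomialOrder.degree_mem_support
        (m := MonomialOrder.lex) hF0))
      rw [Finsupp.sum_fintype _ _ (by simp)]
      rfl
    set μ := shape β with hμ
    have hmem : P μ ∈ Submodule.span K (P '' {μ | MonomialOrder.lex.toSyn (partExp n μ) ≤ s}) :=
      Submodule.subset_span ⟨μ, by rw [Set.mem_ofPred_eq, hshape, hs], rfl⟩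
    let c := coeff β F
    let f' : SymFun K := f + (-c) • P μ
    have hff' : f = f' + c • P μ := by
      rw [add_assoc, ← add_smul, neg_add_cancel, zero_smul, add_zero]
    have hf' : DegLE d f' := hf.add (((hP.degLE μ).mono hsize).smul _)
    have hF' : (toVars K n f' : MvPolynomial (Fin n) K) =
        F + (-c) • (toVars K n (P μ) : MvPolynomial (Fin n) K) := by
      show ((toVars K n (f + (-c) • P μ) : SymPoly K n) : MvPolynomial (Fin n) K) = _
      rw [map_add, map_smul]
      rfl
    have hle : MonomialOrder.lex.degree (toVars K n f' : MvPolynomial (Fin n) K)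
        ≼[MonomialOrder.lex] β := by
      rw [hF']
      refine degree_add_smul_le _ le_rfl ?_
      have := hP.degree_le (n := n) μ
      rwa [hshape] at this
    rw [hff']
    refine Submodule.add_mem _ ?_ (Submodule.smul_mem _ _ hmem)
    by_cases h0' : toVars K n f' = 0
    · rw [eq_zero_of_toVars_eq_zero hd hf' h0']
      exact Submodule.zero_mem _
    have hlt := degree_lt_of_coeff_eq_zero (fun h => h0' (Subtype.ext h)) hle (by
      have h1 := hP.coeff_partExp (n := n) μ (length_shape_le β)
      rw [hshape] at h1
      rw [hF', coeff_add, coeff_smul, h1, smul_eq_mul, mul_one]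
      exact add_neg_cancel _)
    rw [hs] at hlt
    refine Submodule.span_mono (Set.image_mono ?_) (ih _ hlt f' hf' rfl)
    intro ν hν
    exact le_trans hν hlt.le

theorem IsMacdonald.span_eq_top (hP : IsMacdonald q t P) :
    Submodule.span K (Set.range P) = ⊤ := by
  rw [eq_top_iff]
  rintro f -
  obtain ⟨d, hd⟩ := exists_degLE f
  exact Submodule.span_mono (Set.image_subset_range _ _) (hP.mem_span le_rfl f hd)

theorem IsMacdonald.scalarForm_eq_zero [CharZero K] (hP : IsMacdonald q t P) {d : ℕ} (hd : d ≤ n)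
    (f : SymFun K) (hf : DegLE d f) (μ : Ptn)
    (hlt : MonomialOrder.lex.degree (toVars K n f : MvPolynomial (Fin n) K)
      ≺[MonomialOrder.lex] partExp n μ) : scalarForm q t f (P μ) = 0 := by
  have h := hP.mem_span hd f hf
  generalize hγ : MonomialOrder.lex.degree (toVars K n f : MvPolynomial (Fin n) K) = γ at h hlt
  clear hγ hf
  induction h using Submodule.span_induction with
  | mem x hx =>
    obtain ⟨ν, hν, rfl⟩ := hx
    refine hP.orthogonal ν μ fun h => ?_
    rw [h] at hν
    exact absurd (lt_of_le_of_lt hν hlt) (lt_irrefl _)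
  | zero => rw [map_zero, LinearMap.zero_apply]
  | add x y _ _ hx hy => rw [map_add, LinearMap.add_apply, hx, hy, add_zero]
  | smul a x _ hx => rw [map_smul, LinearMap.smul_apply, hx, smul_zero]

/-! ### Eigenvalues -/

theorem Ptn.part_eq_zero (μ : Ptn) {i : ℕ} (h : μ.length ≤ i) : μ.part i = 0 :=
  List.getD_eq_default _ _ (by rw [Multiset.length_sort]; exact h)

/-- The cancellation behind stability, now for scalars: as μ_{n+1} = 0, the new argument is
t^{-(n+1)}, so e_k satisfies the recursion of the rescaled D_n^k. -/
theorem eigE_succ (ht0 : t ≠ 0) (r : ℕ) (μ : Ptn) (hn : μ.length ≤ n) :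
    eigE q t (n + 1) r μ = eigE q t n r μ := by
  refine sum_convolution_eq (V := K) (t⁻¹ ^ (n + 1)) (coeffE t n) (coeffE t (n + 1))
    (esymmFirst (spec q t μ) n) (esymmFirst (spec q t μ) (n + 1)) ?_ (coeffE_succ ht0 n) ?_ ?_ r
  · rw [coeffE_zero, coeffE_zero]
  · rw [esymmFirst_zero, esymmFirst_zero]
  · intro k
    rw [esymmFirst_succ, spec, μ.part_eq_zero hn, pow_zero, one_mul, smul_eq_mul]

theorem eigE_eq (ht0 : t ≠ 0) (r : ℕ) (μ : Ptn) {m : ℕ} (hm : μ.length ≤ m) (hmn : m ≤ n) :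
    eigE q t n r μ = eigE q t m r μ := by
  induction n, hmn using Nat.le_induction with
  | base => rfl
  | succ n hn ih => rw [eigE_succ ht0 r μ (hm.trans hn), ih]

/-- The Macdonald functions are eigenvectors of `E^r`. -/
theorem IsMacdonald.limE_apply [CharZero K] (hP : IsMacdonald q t P) (ht0 : t ≠ 0)
    (hq : ∀ k : ℕ, 0 < k → q ^ k ≠ 1) (ht : ∀ k : ℕ, 0 < k → t ^ k ≠ 1) (r : ℕ) (lam : Ptn) :
    limE q ht0 r (P lam) = eigE q t lam.1 r lam • P lam := by
  set c := eigE q t lam.1 r lam with hc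
  let h : SymFun K := limE q ht0 r (P lam) + (-c) • P lam
  have hEdeg (μ : Ptn) : DegLE μ.1 (limE q ht0 r (P μ)) := fun n =>
    (totalDegree_opE_le q t r _).trans (hP.degLE μ n)
  have hdeg : DegLE lam.1 h := (hEdeg lam).add ((hP.degLE lam).smul _)
  have hEle (n : ℕ) (μ : Ptn) : MonomialOrder.lex.degree (toVars K n (limE q ht0 r (P μ)) :
      MvPolynomial (Fin n) K) ≼[MonomialOrder.lex] partExp n μ :=
    degree_opE_le q t r _ (hP.degree_le μ)
  suffices h0 : h = 0 by
    have h1 : limE q ht0 r (P lam) + (-c) • P lam + c • P lam = c • P lam := by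
      change h + c • P lam = _
      rw [h0, zero_add]
    rwa [add_assoc, ← add_smul, neg_add_cancel, zero_smul, add_zero] at h1
  -- As the P_μ span Λ, it suffices to pair with each P_μ.
  refine eq_zero_of_scalarForm_eq_zero hq ht fun g => ?_
  have hg : g ∈ Submodule.span K (Set.range P) := by rw [hP.span_eq_top]; trivial
  induction hg using Submodule.span_induction with
  | zero => rw [map_zero]
  | add x y _ _ hx hy => rw [map_add, hx, hy, add_zero]
  | smul a x _ hx => rw [map_smul, hx, smul_zero]
  | mem x hx =>
    obtain ⟨μ, rfl⟩ := hx
    let n := max lam.1 μ.1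
    have hlam : lam.1 ≤ n := le_max_left _ _
    have hμ : μ.1 ≤ n := le_max_right _ _
    rcases lt_or_ge (MonomialOrder.lex.toSyn (partExp n μ))
      (MonomialOrder.lex.toSyn (partExp n lam)) with hlt | hge
    -- Here μ < λ: by self-adjointness E^r moves to P_μ, and E^r P_μ stays below λ.
    · have hne : lam ≠ μ := by rintro rfl; exact lt_irrefl _ hlt
      rw [map_add, map_smul, LinearMap.add_apply, LinearMap.smul_apply,
        scalarForm_limE_comm ht0 hq ht, scalarForm_apply q t (P lam) (P μ), hP.orthogonal _ _ hne,
        smul_zero, add_zero, scalarForm_comm]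
      exact hP.scalarForm_eq_zero hμ _ (hEdeg μ) lam (lt_of_le_of_lt (hEle n μ) hlt)
    -- Here μ ≥ λ: the coefficient of `h` at λ cancels by the choice of `c`, so its leading exponent
    -- lies strictly below λ.
    · by_cases h0 : toVars K n h = 0
      · rw [eq_zero_of_toVars_eq_zero hlam hdeg h0, map_zero, LinearMap.zero_apply]
      refine hP.scalarForm_eq_zero hlam h hdeg μ (lt_of_lt_of_le ?_ hge)
      have hh : (toVars K n h : MvPolynomial (Fin n) K) =
          (toVars K n (limE q ht0 r (P lam)) : MvPolynomial (Fin n) K) +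
            (-c) • (toVars K n (P lam) : MvPolynomial (Fin n) K) := by
        show ((toVars K n (limE q ht0 r (P lam) + (-c) • P lam) : SymPoly K n) :
          MvPolynomial (Fin n) K) = _
        rw [map_add, map_smul]
        rfl
      refine degree_lt_of_coeff_eq_zero (fun h => h0 (Subtype.ext h)) ?_ ?_
      · rw [hh]
        exact degree_add_smul_le _ (hEle n lam) (hP.degree_le lam)
      · rw [hh, toVars_limE, coeff_add, coeff_smul, coeff_opE ht0 r _ (hP.degree_le lam),
          hP.coeff_partExp lam ((length_le_size lam).trans hlam),
          eigE_eq ht0 r lam (length_le_size lam) hlam, ← hc, smul_eq_mul]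
        ring

theorem IsMacdonald.toVars_ne_zero (hP : IsMacdonald q t P) {μ : Ptn} (hn : μ.length ≤ n) :
    toVars K n (P μ) ≠ 0 := by
  intro h
  have h1 := hP.coeff_partExp μ hn
  rw [h] at h1
  simp at h1

theorem IsMacdonald.hasEigenvector_opE [CharZero K] (hP : IsMacdonald q t P) (ht0 : t ≠ 0)
    (hq : ∀ k : ℕ, 0 < k → q ^ k ≠ 1) (ht : ∀ k : ℕ, 0 < k → t ^ k ≠ 1) (r : ℕ) {μ : Ptn}
    (hn : μ.length ≤ n) :
    (opE q t n r).HasEigenvector (eigE q t n r μ) (toVars K n (P μ)) := by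
  refine ⟨Module.End.mem_eigenspace_iff.2 ?_, hP.toVars_ne_zero hn⟩
  rw [← toVars_limE q ht0, hP.limE_apply ht0 hq ht, map_smul,
    ← eigE_eq ht0 r μ (length_le_size μ) (le_max_left μ.1 n),
    eigE_eq ht0 r μ hn (le_max_right μ.1 n)]

/-! ### Limits of elementary symmetric functions -/

theorem esymmFirst_zero_succ (y : ℕ → K) (j : ℕ) : esymmFirst y 0 (j + 1) = 0 := by
  simp [esymmFirst, Multiset.esymm, Multiset.powersetCard_zero_right]

/-- This is the ratio of consecutive Gaussian binomials without denominators. Dividing by 1 -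
u^{j+1} lets convergence as N → ∞ pass from j to j + 1. -/
theorem esymmFirst_pow_succ (u : K) (N j : ℕ) :
    (1 - u ^ (j + 1)) * esymmFirst (fun i => u ^ i) N (j + 1) =
      (u ^ j - u ^ N) * esymmFirst (fun i => u ^ i) N j := by
  induction N generalizing j with
  | zero =>
    cases j with
    | zero => simp [esymmFirst_zero_succ]
    | succ j => simp [esymmFirst_zero_succ]
  | succ N ih =>
    rw [esymmFirst_succ]
    cases j with
    | zero =>
      have := ih 0
      simp only [esymmFirst_zero] at this ⊢
      linear_combination this
    | succ j =>
      rw [esymmFirst_succ]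
      linear_combination ih (j + 1) + u ^ (N + 1) * ih j

theorem exists_isEsymmInf_pow [TopologicalSpace K] [IsTopologicalRing K] {u : K}
    (hu : ∀ k : ℕ, 0 < k → u ^ k ≠ 1)
    (hlim : Filter.Tendsto (fun N : ℕ => u ^ N) Filter.atTop (nhds 0)) (j : ℕ) :
    ∃ a, IsEsymmInf (fun i => u ^ i) j a := by
  induction j with
  | zero => exact ⟨1, by simp only [IsEsymmInf, esymmFirst_zero]; exact tendsto_const_nhds⟩
  | succ j ih =>
    obtain ⟨a, ha⟩ := ih
    have h1 : 1 - u ^ (j + 1) ≠ 0 := sub_ne_zero.2 (hu _ j.succ_pos).symm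
    refine ⟨(1 - u ^ (j + 1))⁻¹ * ((u ^ j - 0) * a), ?_⟩
    refine ((tendsto_const_nhds.sub hlim).mul ha |>.const_mul _).congr fun N => ?_
    rw [← esymmFirst_pow_succ, inv_mul_cancel_left₀ h1]

theorem tendsto_coeffE [TopologicalSpace K] [IsTopologicalRing K] {j : ℕ} {a : K}
    (ha : IsEsymmInf (fun i => t⁻¹ ^ i) j a) :
    Filter.Tendsto (fun N => coeffE t N j) Filter.atTop (nhds (prefactor t j * a)) := by
  refine Filter.Tendsto.const_mul _ (ha.comp (Filter.tendsto_atTop_atTop.2 fun b => ⟨b + 1, ?_⟩))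
  intro N hN
  omega

theorem tendsto_eigE [TopologicalSpace K] (ht0 : t ≠ 0) (r : ℕ) (μ : Ptn) :
    Filter.Tendsto (fun N => eigE q t N r μ) Filter.atTop (nhds (eigE q t μ.1 r μ)) := by
  refine tendsto_const_nhds.congr' ?_
  filter_upwards [Filter.eventually_ge_atTop μ.1] with N hN
  exact (eigE_eq ht0 r μ (length_le_size μ) hN).symm

/-- The eigenvalue is eventually constant in N, and the coefficient of e_k in it is 1. So e_k is a
constant minus terms containing smaller e_i, which converge by induction. -/
theorem exists_isEsymmInf_spec [TopologicalSpace K] [IsTopologicalRing K] (ht0 : t ≠ 0) (μ : Ptn)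
    {a : ℕ → K} (ha : ∀ j, IsEsymmInf (fun i => t⁻¹ ^ i) j (a j)) (k : ℕ) :
    ∃ b, IsEsymmInf (spec q t μ) k b := by
  induction k using Nat.strong_induction_on with
  | _ k ih =>
    have hex (j : ℕ) : ∃ b, j ∈ range k → IsEsymmInf (spec q t μ) (k - (j + 1)) b := by
      by_cases hj : j ∈ range k
      · obtain ⟨b, hb⟩ := ih (k - (j + 1)) (by have := mem_range.1 hj; omega)
        exact ⟨b, fun _ => hb⟩
      -- A dummy value outside the range, so that `choose` yields a total function.
      · exact ⟨0, fun h => absurd h hj⟩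
    choose b hb using hex
    refine ⟨eigE q t μ.1 k μ - ∑ j ∈ range k, prefactor t (j + 1) * a (j + 1) * b j, ?_⟩
    refine ((tendsto_eigE ht0 k μ).sub (tendsto_finsetSum (range k) fun j hj =>
      (tendsto_coeffE (ha (j + 1))).mul (hb j hj))).congr fun N => ?_
    have h : eigE q t N k μ =
        ∑ j ∈ range (k + 1), coeffE t N j * esymmFirst (spec q t μ) N (k - j) := rfl
    rw [h, sum_range_succ', coeffE_zero, one_mul, Nat.sub_zero, add_sub_cancel_left]

theorem eigE_eq_sum_of_isEsymmInf [TopologicalSpace K] [IsTopologicalRing K] [T2Space K]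
    (ht0 : t ≠ 0) (μ : Ptn) {a b : ℕ → K} (ha : ∀ j, IsEsymmInf (fun i => t⁻¹ ^ i) j (a j))
    (hb : ∀ k, IsEsymmInf (spec q t μ) k (b k)) (r : ℕ) :
    eigE q t μ.1 r μ = ∑ j ∈ range (r + 1), prefactor t j * a j * b (r - j) :=
  tendsto_nhds_unique (tendsto_eigE ht0 r μ) (tendsto_finsetSum _ fun j _ =>
    (tendsto_coeffE (ha j)).mul (hb (r - j)))

end Macdonald

/-! ### The main theorem -/

theorem mainTheorem5 {K : Type*} [Field K] [CharZero K] (q t : K) (ht0 : t ≠ 0)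
    (hq : ∀ k : ℕ, 0 < k → q ^ k ≠ 1) (ht : ∀ k : ℕ, 0 < k → t ^ k ≠ 1) (r : ℕ) :
    -- stability: `E_{n+1}^r |_{x_{n+1} = 0} = E_n^r`
    (∀ (n : ℕ) (f : Macdonald.SymPoly K (n + 1)),
      Macdonald.res K n (Macdonald.opE q t (n + 1) r f) =
        Macdonald.opE q t n r (Macdonald.res K n f)) ∧
    -- the Macdonald polynomials in `n` variables are eigenvectors of `E_n^r`
    (∀ P : Macdonald.Ptn → Macdonald.SymFun K, Macdonald.IsMacdonald q t P →
      ∀ (n : ℕ) (μ : Macdonald.Ptn), μ.length ≤ n →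
        (Macdonald.opE q t n r).HasEigenvector (Macdonald.eigE q t n r μ)
          (Macdonald.toVars K n (P μ))) ∧
    -- the limit operator `E^r` on `Λ`, and its eigenvectors
    ∃ E : Module.End K (Macdonald.SymFun K),
      (∀ (n : ℕ) (f : Macdonald.SymFun K),
        Macdonald.toVars K n (E f) = Macdonald.opE q t n r (Macdonald.toVars K n f)) ∧
      (∀ E' : Module.End K (Macdonald.SymFun K),
        (∀ (n : ℕ) (f : Macdonald.SymFun K),
          Macdonald.toVars K n (E' f) = Macdonald.opE q t n r (Macdonald.toVars K n f)) →
        E' = E) ∧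
      ∀ P : Macdonald.Ptn → Macdonald.SymFun K, Macdonald.IsMacdonald q t P →
        ∀ (μ : Macdonald.Ptn) [TopologicalSpace K] [IsTopologicalRing K] [T2Space K],
          Filter.Tendsto (fun N : ℕ => t⁻¹ ^ N) Filter.atTop (nhds 0) →
          ∃ a b : ℕ → K,
            (∀ j, Macdonald.IsEsymmInf (fun i => t⁻¹ ^ i) j (a j)) ∧
            (∀ k, Macdonald.IsEsymmInf (Macdonald.spec q t μ) k (b k)) ∧
            E.HasEigenvector
              (∑ j ∈ Finset.range (r + 1), Macdonald.prefactor t j * a j * b (r - j)) (P μ) := by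
  refine ⟨fun n f => Macdonald.res_opE q ht0 r f,
    fun P hP n μ hn => hP.hasEigenvector_opE ht0 hq ht r hn, Macdonald.limE q ht0 r,
    Macdonald.toVars_limE q ht0 r, ?_, ?_⟩
  · intro E' hE'
    refine LinearMap.ext fun f => Macdonald.SymFun.ext fun n => ?_
    rw [hE', Macdonald.toVars_limE]
  · intro P hP μ _ _ _ hlim
    have hu : ∀ k : ℕ, 0 < k → t⁻¹ ^ k ≠ 1 := fun k hk h =>
      ht k hk (by rwa [inv_pow, inv_eq_one] at h)
    choose a ha using Macdonald.exists_isEsymmInf_pow hu hlim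
    choose b hb using Macdonald.exists_isEsymmInf_spec (q := q) ht0 μ ha
    refine ⟨a, b, ha, hb, Module.End.mem_eigenspace_iff.2 ?_, fun h => ?_⟩
    · rw [hP.limE_apply ht0 hq ht, Macdonald.eigE_eq_sum_of_isEsymmInf ht0 μ ha hb]
    · exact hP.toVars_ne_zero (le_refl μ.length) (by rw [h, map_zero])
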